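/- Let $n\ge 2$. Let ${}^{D}\mathrm{Pol}_n$ be the space of monic complex polynomials of degree $n$ with pairwise distinct roots whose sum is $0$, with the topology of the space of coefficients. Let $V_n=(\mathbb{C}\setminus\{0\})^{n-1}/S_{n-1}$ be the space of unordered $(n-1)$-tuples of nonzero complex numbers, with the quotient topology. To $X\in V_n$ associate its $\sigma$-sequence: the eight nonnegative integers, of sum $n-1$, that count the points of $X$, with repetitions, in each of the four open quadrants and the four open coordinate semi-axes of $\mathbb{C}$. Let $\mathcal{V}_n$ be $V_n$ equipped with the decomposition into the sets $S_a$ of all $X$ with a given $\sigma$-sequence $a$. Let $\nu:{}^{D}\mathrm{Pol}_n\to V_n$ send $P$ to the unordered tuple of its critical values $P(r)$, where $r$ runs over the zeros of $P'$ counted with multiplicity. For a closed nowhere dense set $B\subset Y$, a map $f:X\to Y$ of topological spaces is called a finite ramified cover, unramified outside $B$, if $f$ is continuous, open, closed and surjective with finite fibres, $f^{-1}(B)$ is nowhere dense, and $f$ is over $Y\setminus B$ a covering map with a constant finite number of sheets. Theorem. The sets $S_a$ form a stratification of $V_n$: they are a locally finite partition into nonempty locally closed sets, and $S_a\cap\overline{S_b}\ne\emptyset$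 if and only if $S_a\subseteq\overline{S_b}$. The map $\nu$ is a finite ramified cover of $\mathcal{V}_n$. More precisely, let $\Delta\subset V_n$ be the set of tuples in which some value is repeated. Then $\nu:{}^{D}\mathrm{Pol}_n\to V_n$ is a finite ramified cover, unramified outside $\Delta$, and for every stratum $S_a$ the restriction $\nu^{-1}(S_a)\to S_a$ is a finite ramified cover, unramified outside $\Delta\cap S_a$. -/

import Mathlib

open Polynomial

/-! ### Centered monic polynomials with distinct roots -/

/-- Monic complex polynomials of degree `n` with pairwise distinct roots, the sum of which is `0`. -/
def DPol (n : ℕ) : Type :=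
  {P : ℂ[X] // P.Monic ∧ P.natDegree = n ∧ P.roots.Nodup ∧ P.roots.sum = 0}

/-- The topology of `DPol n` is that of the affine space of coefficients. -/
noncomputable instance (n : ℕ) : TopologicalSpace (DPol n) :=
  TopologicalSpace.induced (fun (P : DPol n) (k : ℕ) => P.1.coeff k) inferInstance

/-! ### Unordered tuples of nonzero complex numbers -/

/-- The set `(ℂ ∖ 0)^(n-1) / S_(n-1)` of unordered `(n-1)`-tuples (with repetitions allowed) of
nonzero complex numbers. -/
def VSpace (n : ℕ) : Type :=
  {X : Multiset ℂ // X.card = n - 1 ∧ (0 : ℂ) ∉ X}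

/-- The unordered tuple underlying an ordered tuple of nonzero complex numbers. -/
def VSpace.ofTuple (n : ℕ) (v : Fin (n - 1) → {z : ℂ // z ≠ 0}) : VSpace n :=
  ⟨Finset.univ.val.map fun i => (v i : ℂ), by simp, by
    simp only [Multiset.mem_map, not_exists, not_and]
    exact fun i _ => (v i).2⟩

/-- The quotient topology of `(ℂ ∖ 0)^(n-1)` under forgetting the order; the next two facts
identify the quotient with the orbit space of the symmetric group. -/
noncomputable instance (n : ℕ) : TopologicalSpace (VSpace n) :=
  TopologicalSpace.coinduced (VSpace.ofTuple n) inferInstance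

theorem VSpace.ofTuple_surjective (n : ℕ) : Function.Surjective (VSpace.ofTuple n) := by
  rintro ⟨X, hX, h0⟩
  have hl : X.toList.length = n - 1 := by simpa using hX
  refine ⟨fun i => ⟨X.toList.get (i.cast hl.symm), fun h => h0 ?_⟩, ?_⟩
  · rw [← h, ← Multiset.mem_toList]
    exact List.get_mem _ _
  · apply Subtype.ext
    have h1 : ∀ (L : List ℂ) (m : ℕ) (h : L.length = m),
        (Finset.univ : Finset (Fin m)).val.map (fun i => L.get (i.cast h.symm)) = (L : Multiset ℂ) := by
      rintro L m rfl
      change (((List.finRange L.length).map fun i => L.get i : List ℂ) : Multiset ℂ) = L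
      rw [List.map_get_finRange]
    exact (h1 _ _ hl).trans (Multiset.coe_toList X)

theorem VSpace.ofTuple_eq_iff (n : ℕ) (v w : Fin (n - 1) → {z : ℂ // z ≠ 0}) :
    VSpace.ofTuple n v = VSpace.ofTuple n w ↔ ∃ s : Equiv.Perm (Fin (n - 1)), w = v ∘ s := by
  constructor
  · intro h
    have h' : (Finset.univ.val.map fun i => (v i : ℂ)) = Finset.univ.val.map fun i => (w i : ℂ) :=
      congrArg Subtype.val h
    have e : ∀ c : {z : ℂ // z ≠ 0}, Nonempty ({i // w i = c} ≃ {i // v i = c}) := by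
      intro c
      rw [← Fintype.card_eq, Fintype.card_subtype, Fintype.card_subtype]
      have hc := congrArg (Multiset.count (c : ℂ)) h'
      rw [Multiset.count_map, Multiset.count_map] at hc
      simpa [Finset.card, Finset.filter, Subtype.ext_iff, eq_comm] using hc.symm
    refine ⟨Equiv.ofFiberEquiv fun c => (e c).some, ?_⟩
    funext i
    exact (Equiv.ofFiberEquiv_map (fun c => (e c).some) i).symm
  · rintro ⟨s, rfl⟩
    apply Subtype.ext
    change _ = Finset.univ.val.map ((fun i => (v i : ℂ)) ∘ s)
    rw [← Multiset.map_map, Multiset.map_univ_val_equiv]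
    rfl

/-! ### The map to critical values -/

theorem DPol.card_criticalValues {n : ℕ} (P : DPol n) :
    ((derivative P.1).roots.map fun r => P.1.eval r).card = n - 1 := by
  rw [Multiset.card_map, IsAlgClosed.card_roots_eq_natDegree, natDegree_derivative, P.2.2.1]

theorem DPol.zero_notMem_criticalValues {n : ℕ} (P : DPol n) :
    (0 : ℂ) ∉ (derivative P.1).roots.map fun r => P.1.eval r := by
  simp only [Multiset.mem_map, not_exists, not_and]
  intro r hr h0
  have hP : P.1 ≠ 0 := P.2.1.ne_zero
  have h1 : 1 < P.1.rootMultiplicity r :=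
    (one_lt_rootMultiplicity_iff_isRoot hP).2 ⟨h0, isRoot_of_mem_roots hr⟩
  have h2 := Multiset.nodup_iff_count_le_one.1 P.2.2.2.1 r
  rw [count_roots] at h2
  omega

/-- The map `ν` sending a polynomial to the unordered tuple of its critical values `P r`, where `r`
runs over the critical points of `P` counted with multiplicity. -/
noncomputable def criticalValues (n : ℕ) (P : DPol n) : VSpace n :=
  ⟨(derivative P.1).roots.map fun r => P.1.eval r,
    P.card_criticalValues, P.zero_notMem_criticalValues⟩

/-- The unordered tuples in which some value is repeated. -/
def repeatedLocus (n : ℕ) : Set (VSpace n) :=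
  {X | ¬ X.1.Nodup}

/-! ### The stratification by quadrants and semi-axes -/

/-- The four open quadrants and the four open semi-axes of the plane. -/
inductive Sector : Type
  | quadrantA | quadrantB | quadrantC | quadrantD
  | realPos | realNeg | imagPos | imagNeg
  deriving DecidableEq

instance : Fintype Sector where
  elems := {.quadrantA, .quadrantB, .quadrantC, .quadrantD, .realPos, .realNeg, .imagPos, .imagNeg}
  complete := by intro s; cases s <;> decide

/-- The subset of the plane that a sector names. -/
def Sector.region : Sector → Set ℂ
  | .quadrantA => {z | 0 < z.re ∧ 0 < z.im}
  | .quadrantB => {z | z.re < 0 ∧ 0 < z.im}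
  | .quadrantC => {z | z.re < 0 ∧ z.im < 0}
  | .quadrantD => {z | 0 < z.re ∧ z.im < 0}
  | .realPos => {z | 0 < z.re ∧ z.im = 0}
  | .realNeg => {z | z.re < 0 ∧ z.im = 0}
  | .imagPos => {z | z.re = 0 ∧ 0 < z.im}
  | .imagNeg => {z | z.re = 0 ∧ z.im < 0}

/-- The number of points of `X` (with repetitions) in each sector. -/
noncomputable def sigmaSequence {n : ℕ} (X : VSpace n) (s : Sector) : ℕ :=
  open Classical in X.1.countP (· ∈ s.region)

/-- The possible `σ`-sequences: eight nonnegative integers with sum `n - 1`. -/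
def SigmaIndex (n : ℕ) : Type :=
  {a : Sector → ℕ // ∑ s, a s = n - 1}

/-- The cell of all unordered tuples with a given `σ`-sequence. -/
def stratum (n : ℕ) (a : SigmaIndex n) : Set (VSpace n) :=
  {X | sigmaSequence X = a.1}

/-! ### Stratifications and ramified covers -/

/-- A locally finite partition of `X` into nonempty locally closed strata such that a stratum meets
the closure of another one only if it is contained in it. -/
structure IsStratification {X ι : Type*} [TopologicalSpace X] (S : ι → Set X) : Prop where
  nonempty : ∀ i, (S i).Nonempty
  disjoint : ∀ i j, i ≠ j → Disjoint (S i) (S j)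
  cover : ⋃ i, S i = Set.univ
  locallyFinite : LocallyFinite S
  locallyClosed : ∀ i, IsLocallyClosed (S i)
  frontier : ∀ i j, (S i ∩ closure (S j)).Nonempty ↔ S i ⊆ closure (S j)

/-- `f` is a finite ramified cover, unramified outside `B`: it is continuous, open, closed and
surjective with finite fibres; `B` is closed and nowhere dense with nowhere dense preimage; and
outside `B` the map `f` is a covering with a constant number of sheets. -/
structure IsFiniteRamifiedCover {X Y : Type*} [TopologicalSpace X] [TopologicalSpace Y]
    (f : X → Y) (B : Set Y) : Prop where
  continuous : Continuous f
  isOpenMap : IsOpenMap f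
  isClosedMap : IsClosedMap f
  surjective : Function.Surjective f
  finite_fiber : ∀ y, (f ⁻¹' {y}).Finite
  isClosed_branch : IsClosed B
  nowhereDense_branch : IsNowhereDense B
  nowhereDense_preimage : IsNowhereDense (f ⁻¹' B)
  isCoveringMapOn : IsCoveringMapOn f Bᶜ
  exists_degree : ∃ d : ℕ, ∀ y ∉ B, (f ⁻¹' {y}).ncard = d

/-! ### Connectedness of complements of hyperplanes -/

/-! Put N = n - 1. A centered monic polynomial of degree n is determined by its critical points,
whose sum is 0, and its constant term. Both are encoded in one tuple x in ℂ^N: the critical points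
are x minus its mean, the constant term is the mean. This is equivariant under permutations, so
`critVal`, sending x to the ordered critical values, is a polynomial map ℂ^N → ℂ^N that descends to
ν on the orbit spaces.

Everything rests on `critVal`. It is proper (`isProperMap_critVal`): differences of critical values
are homogeneous of degree N + 1 in the critical points, and they vanish simultaneously only when all
critical points coincide. Its fibres are compact algebraic sets, hence finite
(`finite_critVal_fiber`). Its derivative is invertible where the critical points are distinct
(`exists_hasStrictFDerivAt_critVal`). It is open even at ramification points (`isOpenMap_critVal`),
because the tuples with distinct entries in a small ball form a connected dense subset: only complex
hyperplanes are removed. Open and closed image gives surjectivity.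

Restriction to nonzero critical values corresponds exactly to distinct roots, and passage to orbits
keeps the map open, closed, surjective and with finite fibres. Off the repeated locus ν is locally
injective, so it is a closed local homeomorphism with finite fibres, that is, a covering;
connectedness of the complement makes its degree constant.

The strata are handled with independent positive rescalings of real and imaginary parts, which
preserve every sector and act transitively on each. The cover restricts to any subset of the base in
which the repeated locus is nowhere dense; within a stratum, coinciding entries are separated by
rescaling them by different positive factors. -/

/-- A zero would force `a / (a - b) = s * (1 / 2 + t * I)`, whose slope is `2 * t`; this excludes a
single value of `t`, uniformly in `s`. -/
theorem affineCombination_ne_zero {a b : ℂ} (ha : a ≠ 0) {s t : ℝ}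
    (ht : t ≠ (a / (a - b)).im / (2 * (a / (a - b)).re)) :
    a + (s : ℂ) * ((1 / 2 + t * Complex.I) * (b - a)) ≠ 0 := by
  intro h
  rcases eq_or_ne a b with rfl | hab
  · simp at h; exact ha h
  have hab' : a - b ≠ 0 := sub_ne_zero.2 hab
  have hw : a / (a - b) = (s : ℂ) * (1 / 2 + t * Complex.I) := by
    rw [div_eq_iff hab']; linear_combination h
  have hs : s ≠ 0 := by
    rintro rfl
    simp at h; exact ha h
  apply ht
  rw [hw]
  simp
  field_simp

/-- Complex hyperplanes have real codimension two. Two points are joined through their midpoint,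
displaced in the imaginary direction of the complex line through them; all but finitely many
displacements avoid every hyperplane. -/
theorem isPreconnected_inter_iInter_ne_zero {E J : Type*} [AddCommGroup E] [Module ℂ E]
    [TopologicalSpace E] [ContinuousAdd E] [ContinuousSMul ℂ E] [Finite J]
    {V : Set E} (hV : IsOpen V) (hc : Convex ℝ V) (l : J → E →ₗ[ℂ] ℂ) :
    IsPreconnected {v | v ∈ V ∧ ∀ j, l j v ≠ 0} := by
  have hcs : ContinuousSMul ℝ E := ⟨by
    have : (fun p : ℝ × E => p.1 • p.2) = fun p : ℝ × E => (p.1 : ℂ) • p.2 := by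
      funext p; exact (Complex.coe_smul p.1 p.2).symm
    rw [this]; fun_prop⟩
  apply isPreconnected_of_forall_pair
  rintro x ⟨hxV, hx⟩ y ⟨hyV, hy⟩
  let z : ℝ → E := fun t => x + (1 / 2 + (t : ℂ) * Complex.I) • (y - x)
  have hz : Continuous z := by fun_prop
  have hz0 : z 0 ∈ V := by
    have : z 0 = midpoint ℝ x y := by
      simp only [z, midpoint_eq_smul_add]
      rw [← Complex.coe_smul]
      simp only [Complex.ofReal_zero, zero_mul, add_zero, invOf_eq_inv, one_div, Complex.ofReal_inv,
        Complex.ofReal_ofNat]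
      module
    rw [this]
    exact hc.segment_subset hxV hyV (midpoint_mem_segment x y)
  -- The two families are the bad parameters seen from `x` and from `y`; reversing the roles of the
  -- endpoints replaces `t` by `-t`.
  let B : Set ℝ := (Set.range fun j => (l j x / (l j x - l j y)).im / (2 * (l j x / (l j x - l j y)).re)) ∪
    (Set.range fun j => -((l j y / (l j y - l j x)).im / (2 * (l j y / (l j y - l j x)).re)))
  have hB : B.Finite := (Set.finite_range _).union (Set.finite_range _)
  obtain ⟨t, htV, htB⟩ : ∃ t, z t ∈ V ∧ t ∉ B := by
    have h1 : ∀ᶠ t in nhds (0 : ℝ), z t ∈ V := hz.continuousAt.eventually (hV.mem_nhds hz0)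
    have h2 : {t | z t ∈ V}.Infinite := infinite_of_mem_nhds _ h1
    exact (h2.sdiff hB).nonempty
  have hl : ∀ j, l j (z t) = l j x + (1 / 2 + (t : ℂ) * Complex.I) * (l j y - l j x) := by
    intro j; simp [z]
  have key1 : ∀ j, t ≠ (l j x / (l j x - l j y)).im / (2 * (l j x / (l j x - l j y)).re) :=
    fun j h => htB (Or.inl ⟨j, h.symm⟩)
  have key2 : ∀ j, -t ≠ (l j y / (l j y - l j x)).im / (2 * (l j y / (l j y - l j x)).re) :=
    fun j h => htB (Or.inr ⟨j, by simp [← h]⟩)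
  refine ⟨segment ℝ x (z t) ∪ segment ℝ y (z t), ?_, Or.inl (left_mem_segment ..),
    Or.inr (left_mem_segment ..), ?_⟩
  · rintro w (hw | hw)
    · refine ⟨hc.segment_subset hxV htV hw, fun j => ?_⟩
      rw [segment_eq_image'] at hw
      obtain ⟨s, -, rfl⟩ := hw
      have := affineCombination_ne_zero (s := s) (hx j) (key1 j)
      convert this using 1
      simp only [← Complex.coe_smul, map_add, map_smul, map_sub, hl, smul_eq_mul]
      ring
    · refine ⟨hc.segment_subset hyV htV hw, fun j => ?_⟩
      rw [segment_eq_image'] at hw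
      obtain ⟨s, -, rfl⟩ := hw
      have := affineCombination_ne_zero (s := s) (hy j) (key2 j)
      convert this using 1
      simp only [← Complex.coe_smul, map_add, map_smul, map_sub, hl, smul_eq_mul]
      push_cast
      ring
  · exact (convex_segment ..).isPreconnected.union' ⟨z t, right_mem_segment .., right_mem_segment ..⟩
      (convex_segment ..).isPreconnected

/-! ### Openness, local homeomorphisms and degrees -/

/-- A map with finite fibres into a space that is not locally separated by the complement of the
dense open set `G` is open, provided that it is open over `G` and that `G` has dense preimage. -/
theorem isOpenMap_of_isOpenMap_over_dense {X Y : Type*} [TopologicalSpace X] [TopologicalSpace Y]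
    [LocallyCompactSpace X] [T2Space X] [T2Space Y] {f : X → Y} (hf : Continuous f)
    (hfin : ∀ y, (f ⁻¹' {y}).Finite) {G : Set Y} (hG : IsOpen G) (hGd : Dense G)
    (hGp : Dense (f ⁻¹' G))
    (hloc : ∀ x ∈ f ⁻¹' G, nhds (f x) ≤ Filter.map f (nhds x))
    (hbasis : ∀ y, ∀ O ∈ nhds y, ∃ V ⊆ O, IsOpen V ∧ y ∈ V ∧ IsPreconnected (V ∩ G)) :
    IsOpenMap f := by
  rw [isOpenMap_iff_nhds_le]
  intro x
  rw [Filter.le_map_iff]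
  intro U hU
  have hF : (f ⁻¹' {f x} \ {x})ᶜ ∈ nhds x :=
    ((hfin (f x)).subset Set.sdiff_subset).isClosed.isOpen_compl.mem_nhds (by simp)
  -- `K` meets the fibre of `f x` only at `x`, so the compact image of its boundary misses `f x` and
  -- a small `V` avoids it. Over `V ∩ G` the image of `K` is then both open and closed, hence
  -- everything by connectedness.
  obtain ⟨K, hKx, hKU, hK⟩ := local_compact_nhds (Filter.inter_mem hU hF)
  have hfr : IsCompact (K \ interior K) := hK.diff isOpen_interior
  have hx' : f x ∉ f '' (K \ interior K) := by
    rintro ⟨w, ⟨hw, hwi⟩, hwx⟩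
    have h := (hKU hw).2
    simp only [Set.mem_compl_iff, Set.mem_sdiff, Set.mem_preimage, Set.mem_singleton_iff, hwx,
      true_and, not_not] at h
    rw [h] at hwi
    exact hwi (mem_interior_iff_mem_nhds.2 hKx)
  obtain ⟨V, hVO, hV, hxV, hVc⟩ := hbasis (f x) (f '' (K \ interior K))ᶜ
    ((hfr.image hf).isClosed.isOpen_compl.mem_nhds hx')
  have hsub : V ∩ G ⊆ f '' (interior K) := by
    have hopen : IsOpen (f '' (interior K ∩ f ⁻¹' (V ∩ G))) := by
      rw [isOpen_iff_mem_nhds]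
      rintro _ ⟨w, ⟨hwK, hwV, hwG⟩, rfl⟩
      exact hloc w hwG (Filter.image_mem_map
        ((isOpen_interior.inter ((hV.inter hG).preimage hf)).mem_nhds ⟨hwK, hwV, hwG⟩))
    have hclosed : IsClosed (f '' K) := (hK.image hf).isClosed
    have hne : ((V ∩ G) ∩ f '' (interior K ∩ f ⁻¹' (V ∩ G))).Nonempty := by
      obtain ⟨w, hw, hwG⟩ := hGp.inter_open_nonempty (interior K ∩ f ⁻¹' V)
        (isOpen_interior.inter (hV.preimage hf)) ⟨x, mem_interior_iff_mem_nhds.2 hKx, hxV⟩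
      exact ⟨f w, ⟨hw.2, hwG⟩, w, ⟨hw.1, hw.2, hwG⟩, rfl⟩
    have hcov : V ∩ G ⊆ f '' (interior K ∩ f ⁻¹' (V ∩ G)) ∪ (f '' K)ᶜ := by
      intro y hy
      by_cases h : y ∈ f '' K
      · left
        obtain ⟨w, hw, rfl⟩ := h
        by_cases hwi : w ∈ interior K
        · exact ⟨w, ⟨hwi, hy⟩, rfl⟩
        · exact absurd ⟨w, ⟨hw, hwi⟩, rfl⟩ (hVO hy.1)
      · exact Or.inr h
    have hdisj : Disjoint (f '' (interior K ∩ f ⁻¹' (V ∩ G))) (f '' K)ᶜ := by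
      rw [Set.disjoint_compl_right_iff_subset]
      exact Set.image_mono (Set.inter_subset_left.trans interior_subset)
    have h := hVc.subset_left_of_subset_union hopen hclosed.isOpen_compl hdisj hcov hne
    exact h.trans (Set.image_mono Set.inter_subset_left)
  -- The points of `V` outside `G` are limits of `V ∩ G`, and the compact image `f '' K` is closed.
  refine Filter.mem_of_superset (hV.mem_nhds hxV) fun y hy => ?_
  have hy' : y ∈ closure (V ∩ G) := hGd.open_subset_closure_inter hV hy
  have : y ∈ f '' K := (hK.image hf).isClosed.closure_subset
    (closure_mono (hsub.trans (Set.image_mono interior_subset)) hy')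
  exact Set.image_mono (fun w hw => (hKU hw).1) this

theorem IsOpenMap.isLocalHomeomorphOn_of_injOn {X Y : Type*} [TopologicalSpace X]
    [TopologicalSpace Y] {f : X → Y} (hf : Continuous f) (ho : IsOpenMap f) {s : Set X}
    (hi : ∀ x ∈ s, ∃ U ∈ nhds x, Set.InjOn f U) : IsLocalHomeomorphOn f s := by
  rw [isLocalHomeomorphOn_iff_isOpenEmbedding_restrict]
  intro x hx
  obtain ⟨U, hU, hUi⟩ := hi x hx
  obtain ⟨W, hWU, hW, hxW⟩ := mem_nhds_iff.1 hU
  exact ⟨W, hW.mem_nhds hxW, .of_continuous_injective_isOpenMap (by fun_prop)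
    (Set.injOn_iff_injective.1 (hUi.mono hWU)) (ho.comp hW.isOpenMap_subtype_val)⟩

/-- Local trivializations make the number of sheets locally constant. Surjectivity supplies the
nonempty fibres from which they are built. -/
theorem IsCoveringMapOn.ncard_fiber_eq {X Y : Type*} [TopologicalSpace X]
    [TopologicalSpace Y] {f : X → Y} {s : Set Y} (hf : IsCoveringMapOn f s) (hs : IsPreconnected s)
    (hsurj : Function.Surjective f) {y z : Y} (hy : y ∈ s) (hz : z ∈ s) :
    (f ⁻¹' {y}).ncard = (f ⁻¹' {z}).ncard := by
  have hloc : ∀ w ∈ s, ∀ᶠ u in nhds w, (f ⁻¹' {u}).ncard = (f ⁻¹' {w}).ncard := by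
    intro w hw
    have : Nonempty (f ⁻¹' {w}) := by
      obtain ⟨x, hx⟩ := hsurj w
      exact ⟨⟨x, hx⟩⟩
    let e := (hf w hw).toTrivialization
    have hwb : w ∈ e.baseSet := (hf w hw).mem_toTrivialization_baseSet
    filter_upwards [e.open_baseSet.mem_nhds hwb] with u hu
    exact Nat.card_congr (e.preimageSingletonHomeomorph hu).toEquiv
  have hcont : ContinuousOn (fun y => (f ⁻¹' {y}).ncard) s := fun w hw =>
    (continuousAt_of_tendsto_nhds (y := (f ⁻¹' {w}).ncard)
      (tendsto_nhds_of_eventually_eq (hloc w hw))).continuousWithinAt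
  exact hs.constant hcont hy hz

/-! ### Compact algebraic sets are finite -/

/-- A compact algebraic subset of `ℂ^ι` is finite. -/
theorem MvPolynomial.finite_of_isCompact_zeroLocus {ι : Type} [Finite ι] {J : Type*}
    (p : J → MvPolynomial ι ℂ) (hZ : IsCompact {x : ι → ℂ | ∀ j, eval x (p j) = 0}) :
    {x : ι → ℂ | ∀ j, eval x (p j) = 0}.Finite := by
  set Z := {x : ι → ℂ | ∀ j, eval x (p j) = 0} with hZdef
  rcases Z.eq_empty_or_nonempty with h | ⟨x₀, hx₀⟩
  · rw [h]; exact Set.finite_empty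
  let I : Ideal (MvPolynomial ι ℂ) := Ideal.span (Set.range p)
  have hI : ∀ x ∈ Z, ∀ a ∈ I, aeval x a = 0 := by
    intro x hx a ha
    have : I ≤ RingHom.ker (aeval x : MvPolynomial ι ℂ →ₐ[ℂ] ℂ) := by
      rw [Ideal.span_le]
      rintro _ ⟨j, rfl⟩
      simpa [RingHom.mem_ker, aeval_eq_eval] using hx j
    exact this ha
  let ev : Z → (MvPolynomial ι ℂ ⧸ I) →ₐ[ℂ] ℂ := fun x => Ideal.Quotient.liftₐ I (aeval x.1) (hI x.1 x.2)
  have hev : ∀ x a, ev x (Ideal.Quotient.mk I a) = eval x.1 a := fun x a => by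
    simp [ev]
  have : Nontrivial (MvPolynomial ι ℂ ⧸ I) := (ev ⟨x₀, hx₀⟩).toRingHom.domain_nontrivial
  -- Noether normalization of the coordinate ring: in dimension 0 the points are algebra maps out of
  -- a finite-dimensional algebra, hence finite in number; in positive dimension one coordinate
  -- takes every complex value on the set, which contradicts boundedness.
  obtain ⟨s, g, hginj, hgfin⟩ := exists_finite_inj_algHom_of_fg ℂ (MvPolynomial ι ℂ ⧸ I)
  rcases s with _ | s
  · have hfin : Module.Finite ℂ (MvPolynomial ι ℂ ⧸ I) := by
      have h1 : (g.comp (isEmptyAlgEquiv ℂ (Fin 0)).symm.toAlgHom).Finite :=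
        hgfin.comp (RingHom.Finite.of_surjective _ (isEmptyAlgEquiv ℂ (Fin 0)).symm.surjective)
      have h2 : ((g.comp (isEmptyAlgEquiv ℂ (Fin 0)).symm.toAlgHom) : ℂ →+* _) =
          algebraMap ℂ (MvPolynomial ι ℂ ⧸ I) := by
        ext a; exact (g.comp (isEmptyAlgEquiv ℂ (Fin 0)).symm.toAlgHom).commutes a
      rw [← RingHom.finite_algebraMap, ← h2]
      exact h1
    have hinj : Function.Injective ev := by
      intro x y hxy
      apply Subtype.ext
      funext i
      have := congrArg (fun φ => φ (Ideal.Quotient.mk I (X i))) hxy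
      simpa [hev] using this
    exact Set.finite_coe_iff.1 (Finite.of_injective ev hinj)
  · exfalso
    obtain ⟨P, hP⟩ := Ideal.Quotient.mk_surjective (g (X 0))
    have hcont : Continuous fun x : ι → ℂ => eval x P := MvPolynomial.continuous_eval P
    obtain ⟨B, hB⟩ := (hZ.image hcont).isBounded.exists_norm_le
    obtain ⟨a, ha⟩ : ∃ a : ℂ, B < ‖a‖ := ⟨(|B| + 1 : ℝ), by
      rw [Complex.norm_real, Real.norm_eq_abs, abs_of_pos (by positivity)]
      linarith [le_abs_self B]⟩
    suffices h : ∃ x ∈ Z, eval x P = a by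
      obtain ⟨x, hx, rfl⟩ := h
      exact absurd (hB _ ⟨x, hx, rfl⟩) (not_le.2 ha)
    algebraize [g.toRingHom]
    have : Algebra.IsIntegral (MvPolynomial (Fin (s + 1)) ℂ) (MvPolynomial ι ℂ ⧸ I) := ⟨hgfin.to_isIntegral⟩
    let m : Ideal (MvPolynomial (Fin (s + 1)) ℂ) := RingHom.ker (eval (fun _ => a))
    have hm : m.IsMaximal := RingHom.ker_isMaximal_of_surjective _ (fun b => ⟨C b, by simp⟩)
    -- Lying over gives a maximal ideal above the point with all coordinates `a`; the
    -- Nullstellensatz turns it into a point of the zero locus at which `P` equals `a`.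
    obtain ⟨Q, hQ, hQm⟩ := Ideal.exists_ideal_over_maximal_of_isIntegral (S := MvPolynomial ι ℂ ⧸ I) m (by
      intro b hb
      have : b = 0 := hginj ((RingHom.mem_ker.1 hb).trans (map_zero g).symm)
      rw [this]; exact m.zero_mem)
    have hQ' : (Q.comap (Ideal.Quotient.mk I)).IsMaximal :=
      Ideal.comap_isMaximal_of_surjective _ Ideal.Quotient.mk_surjective
    obtain ⟨x, hx⟩ := isMaximal_iff_eq_vanishingIdeal_singleton.1 hQ'
    have hmem : ∀ b, b ∈ Q.comap (Ideal.Quotient.mk I) ↔ eval x b = 0 := by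
      intro b
      rw [hx, mem_vanishingIdeal_singleton_iff, aeval_eq_eval]
    refine ⟨x, fun j => (hmem _).1 ?_, ?_⟩
    · rw [Ideal.mem_comap, Ideal.Quotient.eq_zero_iff_mem.2 (Ideal.subset_span (Set.mem_range_self j))]
      exact Q.zero_mem
    · have h1 : (X 0 - C a : MvPolynomial (Fin (s + 1)) ℂ) ∈ m := by simp [m, RingHom.mem_ker]
      rw [← hQm, Ideal.mem_comap] at h1
      have h2 : algebraMap (MvPolynomial (Fin (s + 1)) ℂ) (MvPolynomial ι ℂ ⧸ I) (X 0 - C a) =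
          Ideal.Quotient.mk I (P - C a) := by
        change g (X 0 - C a) = _
        rw [map_sub, map_sub, hP]
        congr 1
        exact g.commutes a
      rw [h2, ← Ideal.mem_comap, hmem] at h1
      simpa [sub_eq_zero] using h1

/-! ### Centered polynomials parametrized by their critical points -/

theorem Multiset.exists_map_univ_eq {ι α : Type*} [Fintype ι] (X : Multiset α)
    (hX : X.card = Fintype.card ι) : ∃ v : ι → α, Finset.univ.val.map v = X := by
  obtain ⟨L, rfl⟩ := Quot.exists_rep X
  have hL : L.length = Fintype.card ι := hX
  let e : ι ≃ Fin L.length := (Fintype.equivFin ι).trans (finCongr hL.symm)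
  refine ⟨L.get ∘ e, ?_⟩
  rw [← Multiset.map_map, Multiset.map_univ_val_equiv]
  change (((List.finRange L.length).map L.get : List α) : Multiset α) = L
  rw [List.map_get_finRange]

theorem Multiset.exists_perm_of_map_univ_eq {ι α : Type*} [Fintype ι] {v w : ι → α}
    (h : Finset.univ.val.map v = Finset.univ.val.map w) : ∃ s : Equiv.Perm ι, w = v ∘ s := by
  classical
  have e : ∀ c : α, Nonempty ({i // w i = c} ≃ {i // v i = c}) := by
    intro c
    rw [← Fintype.card_eq, Fintype.card_subtype, Fintype.card_subtype]
    have hc := congrArg (Multiset.count c) h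
    rw [Multiset.count_map, Multiset.count_map] at hc
    simpa [Finset.card, Finset.filter, eq_comm] using hc.symm
  refine ⟨Equiv.ofFiberEquiv fun c => (e c).some, ?_⟩
  funext i
  exact (Equiv.ofFiberEquiv_map (fun c => (e c).some) i).symm

section CenteredPolynomial

variable {ι : Type} [Fintype ι]

/-- The mean value of a tuple of complex numbers. -/
noncomputable def tupleMean (x : ι → ℂ) : ℂ := (∑ i, x i) / Fintype.card ι

/-- The tuple translated so as to have sum zero. -/
noncomputable def tupleCenter (x : ι → ℂ) (i : ι) : ℂ := x i - tupleMean x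

/-- The monic polynomial with the given roots. -/
noncomputable def rootPoly (r : ι → ℂ) : ℂ[X] := ∏ i, (X - C (r i))

/-- The monic polynomial without constant term whose critical points are given. -/
noncomputable def critPoly (r : ι → ℂ) : ℂ[X] :=
  ∑ k ∈ Finset.range (Fintype.card ι + 1),
    C ((Fintype.card ι + 1) / (k + 1) * (rootPoly r).coeff k) * X ^ (k + 1)

/-- The centered monic polynomial with critical points `tupleCenter x` and constant term
`tupleMean x`. -/
noncomputable def centeredPoly (x : ι → ℂ) : ℂ[X] := critPoly (tupleCenter x) + C (tupleMean x)

/-- The ordered critical values of `centeredPoly x`. -/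
noncomputable def critVal (x : ι → ℂ) (i : ι) : ℂ := (centeredPoly x).eval (tupleCenter x i)

theorem sum_tupleCenter (x : ι → ℂ) : ∑ i, tupleCenter x i = 0 := by
  rcases isEmpty_or_nonempty ι with h | h
  · simp
  · have : (Fintype.card ι : ℂ) ≠ 0 := by simp
    simp only [tupleCenter, tupleMean, Finset.sum_sub_distrib, Finset.sum_const, Finset.card_univ,
      nsmul_eq_mul]
    field_simp
    ring

theorem tupleMean_eq_zero {x : ι → ℂ} (h : ∑ i, x i = 0) : tupleMean x = 0 := by
  simp [tupleMean, h]

theorem tupleCenter_eq_self {x : ι → ℂ} (h : ∑ i, x i = 0) : tupleCenter x = x := by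
  funext i; simp [tupleCenter, tupleMean_eq_zero h]

theorem tupleMean_comp_perm (x : ι → ℂ) (s : Equiv.Perm ι) : tupleMean (x ∘ s) = tupleMean x := by
  simp only [tupleMean, Function.comp_apply]
  rw [Equiv.sum_comp s x]

theorem tupleCenter_comp_perm (x : ι → ℂ) (s : Equiv.Perm ι) :
    tupleCenter (x ∘ s) = tupleCenter x ∘ s := by
  funext i; simp [tupleCenter, tupleMean_comp_perm]

theorem rootPoly_comp_perm (r : ι → ℂ) (s : Equiv.Perm ι) : rootPoly (r ∘ s) = rootPoly r :=
  Equiv.prod_comp s fun i => X - C (r i)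

theorem centeredPoly_comp_perm (x : ι → ℂ) (s : Equiv.Perm ι) :
    centeredPoly (x ∘ s) = centeredPoly x := by
  simp only [centeredPoly, critPoly, tupleMean_comp_perm, tupleCenter_comp_perm, rootPoly_comp_perm]

theorem critVal_comp_perm (x : ι → ℂ) (s : Equiv.Perm ι) : critVal (x ∘ s) = critVal x ∘ s := by
  funext i; simp [critVal, centeredPoly_comp_perm, tupleCenter_comp_perm]

theorem rootPoly_monic (r : ι → ℂ) : (rootPoly r).Monic :=
  monic_prod_of_monic _ _ fun _ _ => monic_X_sub_C _

theorem natDegree_rootPoly (r : ι → ℂ) : (rootPoly r).natDegree = Fintype.card ι := by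
  rw [rootPoly, natDegree_prod_of_monic _ _ fun i _ => monic_X_sub_C (r i)]
  simp

theorem roots_rootPoly (r : ι → ℂ) : (rootPoly r).roots = Finset.univ.val.map r := by
  have : rootPoly r = ((Finset.univ.val.map r).map fun a => X - C a).prod := by
    rw [Multiset.map_map]
    rfl
  rw [this, roots_multiset_prod_X_sub_C]

theorem coeff_rootPoly_card (r : ι → ℂ) : (rootPoly r).coeff (Fintype.card ι) = 1 := by
  rw [← natDegree_rootPoly r]; exact rootPoly_monic r

theorem coeff_rootPoly_card_pred [Nonempty ι] (r : ι → ℂ) :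
    (rootPoly r).coeff (Fintype.card ι - 1) = -∑ i, r i :=
  prod_X_sub_C_coeff_card_pred Finset.univ r (by simp [Fintype.card_pos])

theorem coeff_critPoly_zero (r : ι → ℂ) : (critPoly r).coeff 0 = 0 := by
  simp [critPoly]

theorem coeff_critPoly_succ (r : ι → ℂ) (k : ℕ) : (critPoly r).coeff (k + 1) =
    (Fintype.card ι + 1) / (k + 1) * (rootPoly r).coeff k := by
  simp only [critPoly, finsetSum_coeff, coeff_C_mul, coeff_X_pow, add_left_inj, mul_ite, mul_one,
    mul_zero]
  rw [Finset.sum_ite_eq]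
  split_ifs with h
  · rfl
  · rw [coeff_eq_zero_of_natDegree_lt, mul_zero]
    rw [natDegree_rootPoly]
    simpa using h

theorem derivative_critPoly (r : ι → ℂ) :
    derivative (critPoly r) = C (Fintype.card ι + 1 : ℂ) * rootPoly r := by
  ext k
  rw [coeff_derivative, coeff_critPoly_succ, coeff_C_mul]
  have : (k + 1 : ℂ) ≠ 0 := by exact_mod_cast k.succ_ne_zero
  field_simp

theorem derivative_centeredPoly (x : ι → ℂ) :
    derivative (centeredPoly x) = C (Fintype.card ι + 1 : ℂ) * rootPoly (tupleCenter x) := by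
  simp [centeredPoly, derivative_critPoly]

theorem coeff_centeredPoly_zero (x : ι → ℂ) : (centeredPoly x).coeff 0 = tupleMean x := by
  simp [centeredPoly, coeff_critPoly_zero]

theorem coeff_centeredPoly_succ (x : ι → ℂ) (k : ℕ) : (centeredPoly x).coeff (k + 1) =
    (Fintype.card ι + 1) / (k + 1) * (rootPoly (tupleCenter x)).coeff k := by
  simp [centeredPoly, coeff_critPoly_succ]

theorem card_add_one_ne_zero : (Fintype.card ι + 1 : ℂ) ≠ 0 := by
  exact_mod_cast (Fintype.card ι).succ_ne_zero

theorem natDegree_centeredPoly_le (x : ι → ℂ) :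
    (centeredPoly x).natDegree ≤ Fintype.card ι + 1 := by
  rw [natDegree_le_iff_coeff_eq_zero]
  intro k hk
  obtain ⟨k, rfl⟩ : ∃ j, k = j + 1 := ⟨k - 1, by omega⟩
  rw [coeff_centeredPoly_succ, coeff_eq_zero_of_natDegree_lt, mul_zero]
  rw [natDegree_rootPoly]; omega

theorem coeff_centeredPoly_top (x : ι → ℂ) : (centeredPoly x).coeff (Fintype.card ι + 1) = 1 := by
  rw [coeff_centeredPoly_succ, coeff_rootPoly_card, mul_one, div_self card_add_one_ne_zero]

theorem centeredPoly_monic (x : ι → ℂ) : (centeredPoly x).Monic :=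
  monic_of_natDegree_le_of_coeff_eq_one _ (natDegree_centeredPoly_le x) (coeff_centeredPoly_top x)

theorem natDegree_centeredPoly (x : ι → ℂ) : (centeredPoly x).natDegree = Fintype.card ι + 1 :=
  natDegree_eq_of_le_of_coeff_ne_zero (natDegree_centeredPoly_le x)
    (by rw [coeff_centeredPoly_top]; exact one_ne_zero)

theorem roots_derivative_centeredPoly (x : ι → ℂ) :
    (derivative (centeredPoly x)).roots = Finset.univ.val.map (tupleCenter x) := by
  rw [derivative_centeredPoly, roots_C_mul _ card_add_one_ne_zero, roots_rootPoly]

theorem Polynomial.Monic.sum_roots_eq_neg_coeff {P : ℂ[X]} (hP : P.Monic) {N : ℕ}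
    (hd : P.natDegree = N + 1) : P.roots.sum = -P.coeff N := by
  have h := (IsAlgClosed.splits P).nextCoeff_eq_neg_sum_roots_of_monic hP
  rw [nextCoeff_of_natDegree_pos (by omega), hd, Nat.add_sub_cancel] at h
  rw [h, neg_neg]

theorem sum_roots_centeredPoly [Nonempty ι] (x : ι → ℂ) : (centeredPoly x).roots.sum = 0 := by
  rw [(centeredPoly_monic x).sum_roots_eq_neg_coeff (natDegree_centeredPoly x)]
  have h : Fintype.card ι = (Fintype.card ι - 1) + 1 := by have := Fintype.card_pos (α := ι); omega
  rw [h, coeff_centeredPoly_succ, coeff_rootPoly_card_pred, sum_tupleCenter]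
  simp

theorem Polynomial.eq_of_derivative_eq {P Q : ℂ[X]} (h : derivative P = derivative Q)
    (h0 : P.coeff 0 = Q.coeff 0) : P = Q := by
  have h1 : derivative (P - Q) = 0 := by rw [derivative_sub, h, sub_self]
  have h2 := eq_C_of_derivative_eq_zero h1
  rwa [coeff_sub, h0, sub_self, C_0, sub_eq_zero] at h2

theorem exists_centeredPoly_eq [Nonempty ι] {P : ℂ[X]} (hP : P.Monic)
    (hd : P.natDegree = Fintype.card ι + 1) (hs : P.roots.sum = 0) :
    ∃ x : ι → ℂ, centeredPoly x = P := by
  have hdd : (derivative P).natDegree = Fintype.card ι := by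
    rw [natDegree_derivative, hd, Nat.add_sub_cancel]
  have hcard : (derivative P).roots.card = (derivative P).natDegree :=
    IsAlgClosed.card_roots_eq_natDegree
  obtain ⟨r, hr⟩ := (derivative P).roots.exists_map_univ_eq (hcard.trans hdd)
  have hlead : (derivative P).leadingCoeff = Fintype.card ι + 1 := by
    rw [leadingCoeff, hdd, coeff_derivative, ← hd, hP.coeff_natDegree, one_mul]
  have hder : derivative P = C (Fintype.card ι + 1 : ℂ) * rootPoly r := by
    have h := C_leadingCoeff_mul_prod_multiset_X_sub_C hcard
    rw [hlead, ← hr, Multiset.map_map] at h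
    exact h.symm
  have hsum : ∑ i, r i = 0 := by
    have h1 : (derivative P).coeff (Fintype.card ι - 1) = 0 := by
      have h : Fintype.card ι - 1 + 1 = Fintype.card ι := by
        have := Fintype.card_pos (α := ι); omega
      rw [coeff_derivative, h]
      rw [hP.sum_roots_eq_neg_coeff hd, neg_eq_zero] at hs
      rw [hs, zero_mul]
    rw [hder, coeff_C_mul, coeff_rootPoly_card_pred] at h1
    simpa [card_add_one_ne_zero] using h1
  -- Since the critical points have sum zero, adding the constant term to each of them stores it as
  -- the mean.
  have hmean : tupleMean (fun i => r i + P.coeff 0) = P.coeff 0 := by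
    have : (Fintype.card ι : ℂ) ≠ 0 := by simp
    simp only [tupleMean, Finset.sum_add_distrib, hsum, Finset.sum_const, Finset.card_univ,
      nsmul_eq_mul]
    field_simp
    ring
  refine ⟨fun i => r i + P.coeff 0, eq_of_derivative_eq ?_ ?_⟩
  · rw [derivative_centeredPoly, hder]
    congr 2
    funext i
    simp [tupleCenter, hmean]
  · rw [coeff_centeredPoly_zero, hmean]

theorem exists_perm_of_centeredPoly_eq {x y : ι → ℂ} (h : centeredPoly x = centeredPoly y) :
    ∃ s : Equiv.Perm ι, y = x ∘ s := by
  have hm : tupleMean x = tupleMean y := by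
    rw [← coeff_centeredPoly_zero, h, coeff_centeredPoly_zero]
  have hr : Finset.univ.val.map (tupleCenter x) = Finset.univ.val.map (tupleCenter y) := by
    rw [← roots_derivative_centeredPoly, h, roots_derivative_centeredPoly]
  obtain ⟨s, hs⟩ := Multiset.exists_perm_of_map_univ_eq hr
  refine ⟨s, funext fun i => ?_⟩
  have := congrFun hs i
  simp only [tupleCenter, Function.comp_apply, hm, sub_left_inj] at this
  exact this

/-! ### Scaling, and polynomials with a single critical value -/

theorem critVal_eq_sum (x : ι → ℂ) (i : ι) : critVal x i =
    ∑ k ∈ Finset.range (Fintype.card ι + 1),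
      (Fintype.card ι + 1) / (k + 1) * (rootPoly (tupleCenter x)).coeff k *
        tupleCenter x i ^ (k + 1) + tupleMean x := by
  simp [critVal, centeredPoly, critPoly, eval_finsetSum]

theorem critVal_eq_critVal_tupleCenter (x : ι → ℂ) (i : ι) :
    critVal x i = critVal (tupleCenter x) i + tupleMean x := by
  rw [critVal_eq_sum, critVal_eq_sum, tupleCenter_eq_self (sum_tupleCenter x),
    tupleMean_eq_zero (sum_tupleCenter x), add_zero]

/-- Stated without division, so that it also holds for `t = 0`. -/
theorem coeff_rootPoly_smul (t : ℂ) (r : ι → ℂ) (k : ℕ) :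
    (rootPoly (t • r)).coeff k * t ^ k = t ^ Fintype.card ι * (rootPoly r).coeff k := by
  have h : (rootPoly (t • r)).comp (C t * X) = C (t ^ Fintype.card ι) * rootPoly r := by
    rw [rootPoly, prod_comp, rootPoly, C_pow, ← Finset.card_univ, ← Finset.prod_const,
      ← Finset.prod_mul_distrib]
    refine Finset.prod_congr rfl fun i _ => ?_
    simp [mul_sub]
  rw [← coeff_C_mul, ← h, comp_C_mul_X_coeff]

theorem critVal_smul {r : ι → ℂ} (h : ∑ i, r i = 0) (t : ℂ) (i : ι) :
    critVal (t • r) i = t ^ (Fintype.card ι + 1) * critVal r i := by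
  have h' : ∑ i, (t • r) i = 0 := by simp [← Finset.mul_sum, h]
  rw [critVal_eq_sum, critVal_eq_sum, tupleCenter_eq_self h, tupleMean_eq_zero h,
    tupleCenter_eq_self h', tupleMean_eq_zero h', add_zero, add_zero, Finset.mul_sum]
  refine Finset.sum_congr rfl fun k _ => ?_
  rw [Pi.smul_apply, smul_eq_mul, mul_pow, pow_succ t k]
  linear_combination (Fintype.card ι + 1 : ℂ) / (k + 1) * t * r i ^ (k + 1) * coeff_rootPoly_smul t r k

/-- If all critical values of a polynomial agree, then it has a single critical point. -/
theorem tupleCenter_eq_zero_of_critVal_eq {x : ι → ℂ} (h : ∀ i j, critVal x i = critVal x j) :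
    tupleCenter x = 0 := by
  classical
  funext i₀
  have : Nonempty ι := ⟨i₀⟩
  let P := centeredPoly x - C (critVal x i₀)
  have hder : derivative P = derivative (centeredPoly x) := by simp [P]
  have hmon : P.Monic := (centeredPoly_monic x).sub_of_left
    (degree_C_le.trans_lt (by
      rw [degree_eq_natDegree (centeredPoly_monic x).ne_zero, natDegree_centeredPoly]
      exact_mod_cast Nat.succ_pos _))
  have hdeg : P.natDegree = Fintype.card ι + 1 := by
    rw [natDegree_sub_C, natDegree_centeredPoly]
  have hroots : (derivative P).roots = Finset.univ.val.map (tupleCenter x) := by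
    rw [hder, roots_derivative_centeredPoly]
  have hcount : ∀ z ∈ (derivative P).roots.toFinset,
      P.roots.count z = (derivative P).roots.count z + 1 := by
    intro z hz
    rw [Multiset.mem_toFinset, hroots, Multiset.mem_map] at hz
    obtain ⟨j, -, rfl⟩ := hz
    have hroot : P.IsRoot (tupleCenter x j) := by
      rw [IsRoot, eval_sub, eval_C, sub_eq_zero]
      exact h j i₀
    rw [count_roots, count_roots, derivative_rootMultiplicity_of_root hroot]
    have := (rootMultiplicity_pos hmon.ne_zero).2 hroot
    omega
  have h1 : ∑ z ∈ (derivative P).roots.toFinset, P.roots.count z ≤ Fintype.card ι + 1 := by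
    calc _ ≤ ∑ z ∈ (derivative P).roots.toFinset ∪ P.roots.toFinset, P.roots.count z :=
          Finset.sum_le_sum_of_subset Finset.subset_union_left
      _ = P.roots.card := Multiset.sum_count_eq_card fun a ha =>
          Finset.mem_union_right _ (Multiset.mem_toFinset.2 ha)
      _ ≤ P.natDegree := card_roots' P
      _ = _ := hdeg
  have h2 : ∑ z ∈ (derivative P).roots.toFinset, (derivative P).roots.count z = Fintype.card ι := by
    rw [Multiset.toFinset_sum_count_eq, hroots]; simp
  -- Each critical point is a root of `P` of multiplicity one more than in the derivative. With N
  -- the size of `ι`, this gives N + (number of distinct critical points) ≤ N + 1.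
  rw [Finset.sum_congr rfl hcount, Finset.sum_add_distrib, h2, Finset.sum_const, smul_eq_mul,
    mul_one, add_le_add_iff_left, Finset.card_le_one] at h1
  have hmem : ∀ j, tupleCenter x j ∈ (derivative P).roots.toFinset := by
    intro j
    rw [Multiset.mem_toFinset, hroots]
    exact Multiset.mem_map_of_mem _ (Finset.mem_univ j)
  have hsum := sum_tupleCenter x
  rw [Finset.sum_congr rfl fun j _ => h1 _ (hmem j) _ (hmem i₀)] at hsum
  simpa using hsum

end CenteredPolynomial

/-! ### Analytic properties of the ordered critical values -/

/-- The differences of coordinates, indexed by the pairs of distinct indices. -/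
def coordSub {ι : Type} (p : {p : ι × ι // p.1 ≠ p.2}) : (ι → ℂ) →ₗ[ℂ] ℂ :=
  (LinearMap.proj p.1.1 : (ι → ℂ) →ₗ[ℂ] ℂ) - LinearMap.proj p.1.2

theorem injective_iff_coordSub_ne_zero {ι : Type} (v : ι → ℂ) :
    Function.Injective v ↔ ∀ p, coordSub p v ≠ 0 := by
  constructor
  · rintro h ⟨⟨i, j⟩, hij⟩ h0
    exact hij (h (sub_eq_zero.1 h0))
  · intro h i j hij
    by_contra hne
    exact h ⟨(i, j), hne⟩ (sub_eq_zero.2 hij)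

section CriticalValueMap

variable {ι : Type} [Fintype ι]

/-- A complex function on `ι → ℂ` given by a polynomial. -/
def IsPolynomialFun (f : (ι → ℂ) → ℂ) : Prop := ∃ p : MvPolynomial ι ℂ, ∀ x, MvPolynomial.eval x p = f x

theorem isPolynomialFun_tupleMean : IsPolynomialFun (tupleMean : (ι → ℂ) → ℂ) :=
  ⟨MvPolynomial.C (Fintype.card ι : ℂ)⁻¹ * ∑ i, MvPolynomial.X i, fun x => by
    simp [tupleMean, div_eq_inv_mul]⟩

theorem isPolynomialFun_tupleCenter (i : ι) : IsPolynomialFun fun x : ι → ℂ => tupleCenter x i := by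
  obtain ⟨p, hp⟩ := isPolynomialFun_tupleMean (ι := ι)
  exact ⟨MvPolynomial.X i - p, fun x => by simp [hp, tupleCenter]⟩

theorem isPolynomialFun_coeff_rootPoly (k : ℕ) :
    IsPolynomialFun fun x : ι → ℂ => (rootPoly (tupleCenter x)).coeff k := by
  choose p hp using isPolynomialFun_tupleCenter (ι := ι)
  -- The product is formed over the ring of multivariate polynomials and then specialized at `x`.
  refine ⟨(∏ i, (X - C (p i))).coeff k, fun x => ?_⟩
  rw [← coeff_map, Polynomial.map_prod]
  simp [hp, rootPoly]

theorem isPolynomialFun_critVal (i : ι) : IsPolynomialFun fun x : ι → ℂ => critVal x i := by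
  choose q hq using isPolynomialFun_coeff_rootPoly (ι := ι)
  obtain ⟨p, hp⟩ := isPolynomialFun_tupleMean (ι := ι)
  obtain ⟨c, hc⟩ := isPolynomialFun_tupleCenter i
  refine ⟨∑ k ∈ Finset.range (Fintype.card ι + 1),
    MvPolynomial.C ((Fintype.card ι + 1) / (k + 1) : ℂ) * q k * c ^ (k + 1) + p, fun x => ?_⟩
  simp [critVal_eq_sum, hq, hp, hc]

theorem IsPolynomialFun.contDiff {f : (ι → ℂ) → ℂ} (hf : IsPolynomialFun f) : ContDiff ℂ 1 f := by
  obtain ⟨p, hp⟩ := hf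
  have := (AnalyticOnNhd.eval_mvPolynomial p).contDiffOn (n := 1) uniqueDiffOn_univ
  rw [contDiffOn_univ] at this
  exact (funext hp : (fun x => MvPolynomial.eval x p) = f) ▸ this

theorem contDiff_critVal : ContDiff ℂ 1 (critVal : (ι → ℂ) → ι → ℂ) :=
  contDiff_pi.2 fun i => (isPolynomialFun_critVal i).contDiff

theorem continuous_critVal : Continuous (critVal : (ι → ℂ) → ι → ℂ) := contDiff_critVal.continuous

theorem continuous_coeff_centeredPoly (k : ℕ) :
    Continuous fun x : ι → ℂ => (centeredPoly x).coeff k := by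
  rcases k with _ | k
  · simp only [coeff_centeredPoly_zero]
    exact isPolynomialFun_tupleMean.contDiff.continuous
  · simp only [coeff_centeredPoly_succ]
    exact continuous_const.mul (isPolynomialFun_coeff_rootPoly k).contDiff.continuous

/-! ### Properness and finite fibres of the ordered critical value map. -/

theorem isBounded_critVal_preimage [Nonempty ι] (B : ℝ) :
    Bornology.IsBounded {x : ι → ℂ | ∀ i, ‖critVal x i‖ ≤ B} := by
  -- `f` does not see the constant term, scales with degree N + 1 on centered tuples, and is
  -- positive on the compact set `K` because equal critical values force all critical points to be
  -- 0. This bounds the critical points; the mean is then bounded by a single critical value.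
  let f : (ι → ℂ) → ℝ := fun x => ∑ i, ∑ j, ‖critVal x i - critVal x j‖
  have hcv : ∀ i, Continuous fun x : ι → ℂ => critVal x i := fun i =>
    (continuous_apply i).comp continuous_critVal
  have hf : Continuous f := continuous_finsetSum _ fun i _ => continuous_finsetSum _ fun j _ =>
    ((hcv i).sub (hcv j)).norm
  let K : Set (ι → ℂ) := Metric.sphere 0 1 ∩ {r | ∑ i, r i = 0}
  have hK : IsCompact K := (isCompact_sphere 0 1).inter_right
    (isClosed_eq (by fun_prop) continuous_const)
  obtain ⟨ε, hε, hεK⟩ : ∃ ε > 0, ∀ r ∈ K, ε ≤ f r := by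
    rcases K.eq_empty_or_nonempty with h | h
    · exact ⟨1, one_pos, by simp [h]⟩
    · obtain ⟨r, hr, hmin⟩ := hK.exists_isMinOn h hf.continuousOn
      refine ⟨f r, ?_, fun s hs => hmin hs⟩
      have hnn : ∀ i ∈ Finset.univ, 0 ≤ ∑ j, ‖critVal r i - critVal r j‖ :=
        fun i _ => Finset.sum_nonneg fun j _ => norm_nonneg _
      refine lt_of_le_of_ne (Finset.sum_nonneg hnn) fun h0 => ?_
      have hall : ∀ i j, critVal r i = critVal r j := by
        intro i j
        have h1 := (Finset.sum_eq_zero_iff_of_nonneg hnn).1 h0.symm i (Finset.mem_univ i)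
        have h2 := (Finset.sum_eq_zero_iff_of_nonneg fun j _ => norm_nonneg _).1 h1 j
          (Finset.mem_univ j)
        exact sub_eq_zero.1 (norm_eq_zero.1 h2)
      have h3 := tupleCenter_eq_zero_of_critVal_eq hall
      rw [tupleCenter_eq_self hr.2] at h3
      have h4 := hr.1
      simp [h3] at h4
  let N := Fintype.card ι
  let M : ℝ := (∑ _i : ι, ∑ _j : ι, (B + B)) / ε
  have hT : ∀ x : ι → ℂ, (∀ i, ‖critVal x i‖ ≤ B) → ‖tupleCenter x‖ ≤ max 1 M := by
    intro x hx
    rcases le_or_gt ‖tupleCenter x‖ 1 with h1 | h1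
    · exact h1.trans (le_max_left _ _)
    refine le_max_of_le_right ?_
    set t := ‖tupleCenter x‖ with ht
    have ht0 : (t : ℂ) ≠ 0 := by exact_mod_cast (zero_lt_one.trans h1).ne'
    let u : ι → ℂ := (t : ℂ)⁻¹ • tupleCenter x
    have hu0 : ∑ i, u i = 0 := by simp [u, ← Finset.mul_sum, sum_tupleCenter]
    have hu : u ∈ K := by
      refine ⟨?_, hu0⟩
      rw [mem_sphere_zero_iff_norm, norm_smul, norm_inv, Complex.norm_real, Real.norm_eq_abs,
        abs_of_pos (zero_lt_one.trans h1), ← ht]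
      exact inv_mul_cancel₀ (zero_lt_one.trans h1).ne'
    have hux : tupleCenter x = (t : ℂ) • u := by simp [u, smul_smul, ht0]
    have hfx : f x = t ^ (N + 1) * f u := by
      simp only [f, Finset.mul_sum]
      refine Finset.sum_congr rfl fun i _ => Finset.sum_congr rfl fun j _ => ?_
      rw [critVal_eq_critVal_tupleCenter x i, critVal_eq_critVal_tupleCenter x j, hux,
        critVal_smul hu0, critVal_smul hu0, add_sub_add_right_eq_sub, ← mul_sub, norm_mul, norm_pow,
        Complex.norm_real, Real.norm_eq_abs, abs_of_pos (zero_lt_one.trans h1)]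
    have hfB : f x ≤ ∑ _i : ι, ∑ _j : ι, (B + B) :=
      Finset.sum_le_sum fun i _ => Finset.sum_le_sum fun j _ =>
        (norm_sub_le _ _).trans (add_le_add (hx i) (hx j))
    rw [le_div_iff₀ hε]
    calc t * ε ≤ t ^ (N + 1) * f u := by
          refine mul_le_mul ?_ (hεK u hu) hε.le (by positivity)
          exact le_self_pow₀ h1.le (by omega)
      _ = f x := hfx.symm
      _ ≤ _ := hfB
  obtain ⟨i₀⟩ := ‹Nonempty ι›
  obtain ⟨B', hB'⟩ := ((isCompact_closedBall (0 : ι → ℂ) (max 1 M)).image (hcv i₀)).isBounded.exists_norm_le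
  rw [isBounded_iff_forall_norm_le]
  refine ⟨max 1 M + (B + B'), fun x hx => ?_⟩
  have hxT := hT x hx
  have hmean : ‖tupleMean x‖ ≤ B + B' := by
    have h1 : tupleMean x = critVal x i₀ - critVal (tupleCenter x) i₀ := by
      rw [critVal_eq_critVal_tupleCenter x i₀]; ring
    rw [h1]
    exact (norm_sub_le _ _).trans (add_le_add (hx i₀) (hB' _ ⟨_, by simpa using hxT, rfl⟩))
  rw [pi_norm_le_iff_of_nonneg (by
    have := norm_nonneg (tupleCenter x); have := norm_nonneg (tupleMean x); linarith)]
  intro i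
  have h2 : x i = tupleCenter x i + tupleMean x := by simp [tupleCenter]
  rw [h2]
  exact (norm_add_le _ _).trans (add_le_add ((norm_le_pi_norm _ i).trans hxT) hmean)

theorem isCompact_critVal_preimage [Nonempty ι] {K : Set (ι → ℂ)} (hK : IsCompact K) :
    IsCompact (critVal ⁻¹' K) := by
  refine Metric.isCompact_of_isClosed_isBounded (hK.isClosed.preimage continuous_critVal) ?_
  obtain ⟨B, hB⟩ := hK.isBounded.exists_norm_le
  exact (isBounded_critVal_preimage B).subset fun x hx i => (norm_le_pi_norm _ i).trans (hB _ hx)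

theorem isProperMap_critVal [Nonempty ι] : IsProperMap (critVal : (ι → ℂ) → ι → ℂ) :=
  isProperMap_iff_isCompact_preimage.2 ⟨continuous_critVal, fun _ => isCompact_critVal_preimage⟩

/-- The fibre is algebraic, and compact by properness. -/
theorem finite_critVal_fiber [Nonempty ι] (v : ι → ℂ) : (critVal ⁻¹' {v}).Finite := by
  choose p hp using isPolynomialFun_critVal (ι := ι)
  have h : critVal ⁻¹' {v} =
      {x | ∀ i, MvPolynomial.eval x (p i - MvPolynomial.C (v i)) = 0} := by
    ext x
    simp [hp, sub_eq_zero, funext_iff]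
  have hc := isCompact_critVal_preimage (isCompact_singleton (x := v))
  rw [h] at hc ⊢
  exact MvPolynomial.finite_of_isCompact_zeroLocus _ hc

/-! ### Invertibility of the derivative at distinct critical points. -/

theorem tupleCenter_add_smul (x δ : ι → ℂ) (t : ℂ) :
    tupleCenter (x + t • δ) = tupleCenter x + t • tupleCenter δ := by
  funext i
  simp only [tupleCenter, tupleMean, Pi.add_apply, Pi.smul_apply, smul_eq_mul,
    Finset.sum_add_distrib, ← Finset.mul_sum]
  ring

theorem tupleMean_add_smul (x δ : ι → ℂ) (t : ℂ) :
    tupleMean (x + t • δ) = tupleMean x + t * tupleMean δ := by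
  simp only [tupleMean, Pi.add_apply, Pi.smul_apply, smul_eq_mul, Finset.sum_add_distrib,
    ← Finset.mul_sum]
  ring

/-- A direction in which the critical values are stationary vanishes if the critical points are
distinct. -/
theorem eq_zero_of_hasDerivAt_critVal [Nonempty ι] {x δ : ι → ℂ} (hx : Function.Injective x)
    (h : ∀ i, HasDerivAt (fun t : ℂ => critVal (x + t • δ) i) 0 0) : δ = 0 := by
  classical
  let N := Fintype.card ι
  let q : ℕ → ℂ → ℂ := fun k t => (rootPoly (tupleCenter (x + t • δ))).coeff k
  let q' : ℕ → ℂ := fun k => deriv (q k) 0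
  have hq : ∀ k, HasDerivAt (q k) (q' k) 0 := by
    intro k
    apply DifferentiableAt.hasDerivAt
    have h1 := (isPolynomialFun_coeff_rootPoly (ι := ι) k).contDiff.differentiable one_ne_zero
    have h2 : Differentiable ℂ fun t : ℂ => x + t • δ := by fun_prop
    exact (h1.comp h2) 0
  let r := tupleCenter x
  let ρ := tupleCenter δ
  have hr : Function.Injective r := fun i j hij => hx (by simpa [r, tupleCenter] using hij)
  have hri : ∀ i, HasDerivAt (fun t : ℂ => tupleCenter (x + t • δ) i) (ρ i) 0 := by
    intro i
    have : (fun t : ℂ => tupleCenter (x + t • δ) i) = fun t => r i + t * ρ i := by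
      funext t; simp [tupleCenter_add_smul, r, ρ]
    rw [this]
    simpa using ((hasDerivAt_id (0 : ℂ)).mul_const (ρ i)).const_add (r i)
  have hmean : HasDerivAt (fun t : ℂ => tupleMean (x + t • δ)) (tupleMean δ) 0 := by
    simp only [tupleMean_add_smul]
    simpa using ((hasDerivAt_id (0 : ℂ)).mul_const (tupleMean δ)).const_add (tupleMean x)
  have hq0 : ∀ k, q k 0 = (rootPoly r).coeff k := by intro k; simp [q, r]
  -- `D` is the derivative at `t = 0` of the moving polynomial, taken coefficientwise.
  let D : ℂ[X] := ∑ k ∈ Finset.range (N + 1), C ((N + 1) / (k + 1) * q' k) * X ^ (k + 1) +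
    C (tupleMean δ)
  have hroot : ∀ i, (rootPoly r).eval (r i) = 0 := by
    intro i
    rw [rootPoly, eval_prod]
    exact Finset.prod_eq_zero (Finset.mem_univ i) (by simp)
  have hDeval : ∀ i, D.eval (r i) = 0 := by
    intro i
    have h1 : HasDerivAt (fun t : ℂ => critVal (x + t • δ) i)
        (∑ k ∈ Finset.range (N + 1), ((N + 1) / (k + 1) * q' k * r i ^ (k + 1) +
          (N + 1) / (k + 1) * (rootPoly r).coeff k * ((k + 1) * r i ^ k * ρ i)) + tupleMean δ) 0 := by
      simp only [critVal_eq_sum]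
      refine HasDerivAt.add (HasDerivAt.fun_sum fun k _ => ?_) hmean
      have h2 := ((hq k).const_mul ((N + 1) / (k + 1) : ℂ)).mul ((hri i).pow (k + 1))
      refine h2.congr_deriv ?_
      simp [hq0, r]
    have h3 := h1.unique (h i)
    -- The motion of the critical point contributes the derivative of the polynomial evaluated at
    -- that point, which is 0; so the velocity of the critical value is just `D.eval (r i)`.
    have h4 : ∑ k ∈ Finset.range (N + 1),
        ((N + 1) / (k + 1) * (rootPoly r).coeff k * ((k + 1) * r i ^ k * ρ i)) = 0 := by
      have h5 := hroot i
      rw [eval_eq_sum_range, natDegree_rootPoly] at h5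
      calc _ = (N + 1) * ρ i * ∑ k ∈ Finset.range (N + 1), (rootPoly r).coeff k * r i ^ k := by
            rw [Finset.mul_sum]
            refine Finset.sum_congr rfl fun k _ => ?_
            have : (k + 1 : ℂ) ≠ 0 := by exact_mod_cast k.succ_ne_zero
            field_simp
        _ = 0 := by rw [h5, mul_zero]
    rw [Finset.sum_add_distrib, h4, add_zero] at h3
    simpa [D, eval_finsetSum] using h3
  have hqN : q' N = 0 := by
    have : q N = fun _ => 1 := by funext t; exact coeff_rootPoly_card _
    simp [q', this]
  have hqN' : q' (N - 1) = 0 := by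
    have : q (N - 1) = fun _ => 0 := by
      funext t
      exact (coeff_rootPoly_card_pred _).trans (by rw [sum_tupleCenter, neg_zero])
    simp [q', this]
  have hNpos : 0 < N := Fintype.card_pos
  -- The polynomials stay monic and centered, so the two top terms of `D` drop out: its degree is
  -- below N, yet it vanishes at N distinct points.
  have hD0 : D = 0 := by
    refine eq_zero_of_natDegree_lt_card_of_eval_eq_zero D hr hDeval ?_
    have hN : N = (N - 1) + 1 := by omega
    have hD' : D = ∑ k ∈ Finset.range (N - 1), C ((N + 1) / (k + 1) * q' k) * X ^ (k + 1) +
        C (tupleMean δ) := by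
      have h6 : Finset.range (N + 1) = Finset.range (N - 1 + 1 + 1) := by rw [← hN]
      simp only [D]
      rw [h6, Finset.sum_range_succ, Finset.sum_range_succ, ← hN, hqN, hqN']
      simp
    have hle : D.natDegree ≤ N - 1 := by
      rw [hD']
      refine natDegree_add_le_of_degree_le (natDegree_sum_le_of_forall_le _ _ fun k hk => ?_)
        (by rw [natDegree_C]; exact Nat.zero_le _)
      rw [Finset.mem_range] at hk
      exact (natDegree_C_mul_X_pow_le _ _).trans (by omega)
    show D.natDegree < N
    omega
  have hcoeff : ∀ k < N + 1, q' k = 0 := by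
    intro k hk
    have h1 : D.coeff (k + 1) = (N + 1) / (k + 1) * q' k := by
      simp only [D, coeff_add, finsetSum_coeff, coeff_C_mul, coeff_X_pow, add_left_inj, mul_ite,
        mul_one, mul_zero, coeff_C_succ, add_zero]
      rw [Finset.sum_ite_eq, if_pos (Finset.mem_range.2 hk)]
    rw [hD0, coeff_zero, eq_comm, mul_eq_zero] at h1
    refine h1.resolve_left (div_ne_zero card_add_one_ne_zero ?_)
    exact_mod_cast k.succ_ne_zero
  have hmean0 : tupleMean δ = 0 := by
    have h1 : D.coeff 0 = tupleMean δ := by simp [D, finsetSum_coeff]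
    rw [← h1, hD0, coeff_zero]
  -- All coefficients of the moving polynomial of critical points are stationary. Evaluating the
  -- derivative of its product form at `z = r i` isolates `ρ i` times a nonzero product of
  -- differences.
  have hprod : ∀ z : ℂ, ∑ i, (∏ j ∈ Finset.univ.erase i, (z - r j)) • (-ρ i) = 0 := by
    intro z
    have h1 : HasDerivAt (fun t : ℂ => ∏ i, (z - tupleCenter (x + t • δ) i))
        (∑ i, (∏ j ∈ Finset.univ.erase i, (z - r j)) • (-ρ i)) 0 := by
      have h2 := HasDerivAt.fun_finsetProd (u := Finset.univ) fun i _ => (hri i).const_sub z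
      simpa [r] using h2
    have h2 : HasDerivAt (fun t : ℂ => ∏ i, (z - tupleCenter (x + t • δ) i)) 0 0 := by
      have h3 : (fun t : ℂ => ∏ i, (z - tupleCenter (x + t • δ) i)) =
          fun t => ∑ k ∈ Finset.range (N + 1), q k t * z ^ k := by
        funext t
        have h4 : ∏ i, (z - tupleCenter (x + t • δ) i) =
            (rootPoly (tupleCenter (x + t • δ))).eval z := by
          simp [rootPoly, eval_prod]
        rw [h4, eval_eq_sum_range, natDegree_rootPoly]
      rw [h3]
      refine (HasDerivAt.fun_sum fun k _ => (hq k).mul_const (z ^ k)).congr_deriv ?_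
      exact Finset.sum_eq_zero fun k hk => by rw [hcoeff k (Finset.mem_range.1 hk), zero_mul]
    exact h1.unique h2
  funext i
  have h1 := hprod (r i)
  rw [Finset.sum_eq_single i, smul_eq_mul, mul_eq_zero] at h1
  · have h2 : ∏ j ∈ Finset.univ.erase i, (r i - r j) ≠ 0 :=
      Finset.prod_ne_zero_iff.2 fun j hj => sub_ne_zero.2 fun hij => (Finset.ne_of_mem_erase hj) (hr hij).symm
    have h3 : ρ i = 0 := neg_eq_zero.1 (h1.resolve_left h2)
    simpa [ρ, tupleCenter, hmean0] using h3
  · intro j _ hj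
    rw [Finset.prod_eq_zero (Finset.mem_erase.2 ⟨hj.symm, Finset.mem_univ i⟩) (sub_self _), zero_smul]
  · simp

theorem exists_hasStrictFDerivAt_critVal [Nonempty ι] {x : ι → ℂ} (hx : Function.Injective x) :
    ∃ e : (ι → ℂ) ≃L[ℂ] (ι → ℂ), HasStrictFDerivAt critVal (e : (ι → ℂ) →L[ℂ] (ι → ℂ)) x := by
  have hd : HasStrictFDerivAt critVal (fderiv ℂ critVal x) x :=
    contDiff_critVal.contDiffAt.hasStrictFDerivAt one_ne_zero
  have hinj : Function.Injective (fderiv ℂ critVal x : (ι → ℂ) →ₗ[ℂ] (ι → ℂ)) := by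
    rw [injective_iff_map_eq_zero]
    intro δ hδ
    refine eq_zero_of_hasDerivAt_critVal hx fun i => ?_
    have hline : HasDerivAt (fun t : ℂ => x + t • δ) δ 0 := by
      simpa using ((hasDerivAt_id (0 : ℂ)).smul_const δ).const_add x
    have h0 : HasFDerivAt critVal (fderiv ℂ critVal x) (x + (0 : ℂ) • δ) := by
      simpa using hd.hasFDerivAt
    have h1 := h0.comp_hasDerivAt (0 : ℂ) hline
    have h2 : fderiv ℂ critVal x δ = 0 := hδ
    rw [h2] at h1
    exact (hasDerivAt_pi.1 h1) i
  let e := (LinearEquiv.ofInjectiveEndo _ hinj).toContinuousLinearEquiv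
  refine ⟨e, ?_⟩
  have : (e : (ι → ℂ) →L[ℂ] (ι → ℂ)) = fderiv ℂ critVal x := by ext1 v; rfl
  rwa [this]

theorem map_nhds_critVal [Nonempty ι] {x : ι → ℂ} (hx : Function.Injective x) :
    Filter.map critVal (nhds x) = nhds (critVal x) := by
  obtain ⟨e, he⟩ := exists_hasStrictFDerivAt_critVal hx
  exact he.map_nhds_eq_of_equiv

theorem exists_injOn_critVal [Nonempty ι] {x : ι → ℂ} (hx : Function.Injective x) :
    ∃ U ∈ nhds x, Set.InjOn critVal U := by
  obtain ⟨e, he⟩ := exists_hasStrictFDerivAt_critVal hx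
  exact ⟨_, (he.toOpenPartialHomeomorph critVal).open_source.mem_nhds
    he.mem_toOpenPartialHomeomorph_source, (he.toOpenPartialHomeomorph critVal).injOn⟩

theorem injective_of_injective_critVal {x : ι → ℂ} (h : Function.Injective (critVal x)) :
    Function.Injective x := fun i j hij => h (by simp [critVal, tupleCenter, hij])

/-! ### Tuples with distinct entries -/

theorem isOpen_setOf_injective : IsOpen {v : ι → ℂ | Function.Injective v} := by
  have : {v : ι → ℂ | Function.Injective v} = ⋂ i, ⋂ j, {v | v i = v j → i = j} := by
    ext v; simp [Function.Injective]
  rw [this]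
  refine isOpen_iInter_of_finite fun i => isOpen_iInter_of_finite fun j => ?_
  by_cases hij : i = j
  · simp [hij]
  · simp only [hij, imp_false]
    exact isOpen_ne_fun (continuous_apply i) (continuous_apply j)

/-- Unequal entries stay unequal for small `t`, and equal ones are separated by `w` at once; there
are finitely many pairs. -/
theorem eventually_injective_add_smul {v w : ι → ℂ} (h : ∀ i j, i ≠ j → v i = v j → w i ≠ w j) :
    ∀ᶠ t : ℝ in nhdsWithin 0 (Set.Ioi 0), Function.Injective (v + (t : ℂ) • w) := by
  have h1 : ∀ i j, ∀ᶠ t : ℝ in nhdsWithin 0 (Set.Ioi 0),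
      (v + (t : ℂ) • w) i = (v + (t : ℂ) • w) j → i = j := by
    intro i j
    by_cases hij : i = j
    · exact Filter.Eventually.of_forall fun _ _ => hij
    by_cases hv : v i = v j
    · filter_upwards [self_mem_nhdsWithin] with t ht heq
      have ht' : (t : ℂ) ≠ 0 := by exact_mod_cast (ne_of_gt ht)
      simp only [Pi.add_apply, Pi.smul_apply, smul_eq_mul, hv, add_right_inj] at heq
      exact absurd (mul_left_cancel₀ ht' heq) (h i j hij hv)
    · have hcont : Continuous fun t : ℝ => (v + (t : ℂ) • w) i - (v + (t : ℂ) • w) j := by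
        simp only [Pi.add_apply, Pi.smul_apply]
        fun_prop
      have h0 : (v + ((0 : ℝ) : ℂ) • w) i - (v + ((0 : ℝ) : ℂ) • w) j ≠ 0 := by
        simpa [sub_eq_zero] using hv
      have := hcont.continuousAt.eventually_ne h0
      filter_upwards [nhdsWithin_le_nhds this] with t ht heq
      exact absurd (sub_eq_zero.2 heq) ht
  filter_upwards [Filter.eventually_all.2 fun i => Filter.eventually_all.2 (h1 i)] with t ht i j hij
  exact ht i j hij

theorem exists_injective_tuple : ∃ w : ι → ℂ, Function.Injective w :=
  ⟨fun i => ((Fintype.equivFin ι i : ℕ) : ℂ), fun i j hij => by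
    exact (Fintype.equivFin ι).injective (Fin.ext (Nat.cast_injective hij))⟩

theorem dense_setOf_injective : Dense {v : ι → ℂ | Function.Injective v} := by
  intro v
  obtain ⟨w, hw⟩ := exists_injective_tuple (ι := ι)
  have hlim : Filter.Tendsto (fun t : ℝ => v + (t : ℂ) • w) (nhdsWithin 0 (Set.Ioi (0 : ℝ))) (nhds v) := by
    have : Continuous fun t : ℝ => v + (t : ℂ) • w := by fun_prop
    have h := this.tendsto 0
    simp only [Complex.ofReal_zero, zero_smul, add_zero] at h
    exact h.mono_left nhdsWithin_le_nhds
  exact mem_closure_of_tendsto hlim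
    (eventually_injective_add_smul fun i j hij _ h => hij (hw h))

/-- Tuples with distinct entries are dense, and near such a tuple the map is open, so distinct
critical values occur arbitrarily close by. -/
theorem dense_critVal_preimage_injective [Nonempty ι] :
    Dense (critVal ⁻¹' {v : ι → ℂ | Function.Injective v}) := by
  rw [dense_iff_inter_open]
  intro U hU hne
  obtain ⟨x, hxU, hx⟩ := dense_setOf_injective.inter_open_nonempty U hU hne
  have himg : critVal '' U ∈ nhds (critVal x) := by
    rw [← map_nhds_critVal hx]
    exact Filter.image_mem_map (hU.mem_nhds hxU)
  obtain ⟨_, ⟨y, hy, rfl⟩, hy'⟩ := mem_closure_iff_nhds.1 (dense_setOf_injective (critVal x)) _ himg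
  exact ⟨y, hy, hy'⟩

theorem isPreconnected_ball_inter_injective (v : ι → ℂ) (ε : ℝ) :
    IsPreconnected (Metric.ball v ε ∩ {v : ι → ℂ | Function.Injective v}) := by
  have h := isPreconnected_inter_iInter_ne_zero (Metric.isOpen_ball (x := v) (ε := ε))
    (convex_ball v ε) coordSub
  simp only [← injective_iff_coordSub_ne_zero] at h
  exact h

theorem isPreconnected_injective_ne_zero :
    IsPreconnected {v : ι → ℂ | Function.Injective v ∧ ∀ i, v i ≠ 0} := by
  have h := isPreconnected_inter_iInter_ne_zero (isOpen_univ (X := ι → ℂ)) convex_univ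
    (Sum.elim coordSub fun i => LinearMap.proj i)
  convert h using 1
  ext w
  simp [injective_iff_coordSub_ne_zero]

theorem isOpenMap_critVal [Nonempty ι] : IsOpenMap (critVal : (ι → ℂ) → ι → ℂ) := by
  refine isOpenMap_of_isOpenMap_over_dense continuous_critVal finite_critVal_fiber
    isOpen_setOf_injective dense_setOf_injective dense_critVal_preimage_injective
    (fun x hx => (map_nhds_critVal (injective_of_injective_critVal hx)).ge) fun v O hO => ?_
  obtain ⟨ε, hε, hb⟩ := Metric.mem_nhds_iff.1 hO
  exact ⟨_, hb, Metric.isOpen_ball, Metric.mem_ball_self hε, isPreconnected_ball_inter_injective v ε⟩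

theorem surjective_critVal [Nonempty ι] : Function.Surjective (critVal : (ι → ℂ) → ι → ℂ) := by
  rw [← Set.range_eq_univ]
  exact IsClopen.eq_univ ⟨isProperMap_critVal.isClosedMap.isClosed_range, isOpenMap_critVal.isOpen_range⟩
    (Set.range_nonempty _)

theorem isBounded_coeff_preimage [Nonempty ι] (B : ℝ) :
    Bornology.IsBounded {x : ι → ℂ | ∀ k ≤ Fintype.card ι, ‖(centeredPoly x).coeff k‖ ≤ B} := by
  rw [isBounded_iff_forall_norm_le]
  let N : ℝ := Fintype.card ι
  refine ⟨(N * B + 1) + B, fun x hx => ?_⟩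
  have hmean : ‖tupleMean x‖ ≤ B := by
    rw [← coeff_centeredPoly_zero]
    exact hx 0 (Nat.zero_le _)
  have hB : 0 ≤ B := (norm_nonneg _).trans hmean
  have hcoeff : ∀ k < Fintype.card ι, ‖(rootPoly (tupleCenter x)).coeff k‖ ≤ N * B := by
    intro k hk
    have h1 := hx (k + 1) hk
    have hk1 : (k + 1 : ℂ) ≠ 0 := by exact_mod_cast k.succ_ne_zero
    have h2 : (rootPoly (tupleCenter x)).coeff k =
        (k + 1) / (Fintype.card ι + 1) * (centeredPoly x).coeff (k + 1) := by
      rw [coeff_centeredPoly_succ]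
      have := card_add_one_ne_zero (ι := ι)
      field_simp
    -- A crude bound suffices: the denominator is at least 1 and the numerator at most N.
    have h3 : ‖((k + 1) / (Fintype.card ι + 1) : ℂ)‖ ≤ N := by
      have e1 : ((k + 1) / (Fintype.card ι + 1) : ℂ) = (((k + 1) / (Fintype.card ι + 1) : ℝ) : ℂ) := by
        push_cast; rfl
      rw [e1, Complex.norm_real, Real.norm_eq_abs, abs_of_nonneg (by positivity)]
      have e2 : ((k : ℝ) + 1) ≤ (Fintype.card ι : ℝ) := by exact_mod_cast hk
      exact (div_le_self (by positivity) (by linarith [(Nat.cast_nonneg (Fintype.card ι) : (0:ℝ) ≤ _)])).trans e2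
    rw [h2, norm_mul]
    exact mul_le_mul h3 h1 (norm_nonneg _) (Nat.cast_nonneg _)
  have hcenter : ∀ i, ‖tupleCenter x i‖ ≤ N * B + 1 := by
    intro i
    have hroot : (rootPoly (tupleCenter x)).IsRoot (tupleCenter x i) := by
      rw [← mem_roots (rootPoly_monic _).ne_zero, roots_rootPoly]
      exact Multiset.mem_map_of_mem _ (Finset.mem_univ i)
    have h1 := (hroot.norm_lt_cauchyBound (rootPoly_monic _).ne_zero).le
    let M : NNReal := ⟨N * B, by positivity⟩
    have h2 : cauchyBound (rootPoly (tupleCenter x)) ≤ M + 1 := by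
      rw [cauchyBound, (rootPoly_monic _).leadingCoeff, nnnorm_one, div_one, natDegree_rootPoly]
      gcongr
      refine Finset.sup_le fun k hk => ?_
      exact hcoeff k (Finset.mem_range.1 hk)
    exact h1.trans (NNReal.coe_le_coe.2 h2)
  rw [pi_norm_le_iff_of_nonneg (by positivity)]
  intro i
  have h2 : x i = tupleCenter x i + tupleMean x := by simp [tupleCenter]
  rw [h2]
  exact (norm_add_le _ _).trans (add_le_add (hcenter i) hmean)

/-- Properness of the parametrization by critical points; it is what makes the coefficient topology
on `DPol n` a quotient topology. -/
theorem isClosedMap_coeff_centeredPoly [Nonempty ι] :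
    IsClosedMap fun (x : ι → ℂ) (k : ℕ) => (centeredPoly x).coeff k := by
  have hc : Continuous fun (x : ι → ℂ) (k : ℕ) => (centeredPoly x).coeff k :=
    continuous_pi continuous_coeff_centeredPoly
  refine (isProperMap_iff_isCompact_preimage.2 ⟨hc, fun K hK => ?_⟩).isClosedMap
  refine Metric.isCompact_of_isClosed_isBounded (hK.isClosed.preimage hc) ?_
  have hk : ∀ k : ℕ, ∃ B : ℝ, ∀ a ∈ K, ‖a k‖ ≤ B := by
    intro k
    obtain ⟨B, hB⟩ := (hK.image (continuous_apply k)).isBounded.exists_norm_le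
    exact ⟨B, fun a ha => hB _ ⟨a, ha, rfl⟩⟩
  choose B hB using hk
  obtain ⟨M, hM⟩ := ((Finset.range (Fintype.card ι + 1)).image B).bddAbove
  refine (isBounded_coeff_preimage M).subset fun x hx k hkN => (hB k _ hx).trans (hM ?_)
  exact Finset.mem_coe.2 (Finset.mem_image_of_mem _ (Finset.mem_range.2 (by omega)))

end CriticalValueMap

/-! ### Ordered and unordered tuples of nonzero numbers -/

namespace VSpace

theorem continuous_ofTuple (n : ℕ) : Continuous (ofTuple n) := continuous_coinduced_rng

theorem preimage_ofTuple_image (n : ℕ) (U : Set (Fin (n - 1) → {z : ℂ // z ≠ 0})) :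
    ofTuple n ⁻¹' (ofTuple n '' U) = ⋃ s : Equiv.Perm (Fin (n - 1)), (fun v => v ∘ s) ⁻¹' U := by
  ext v
  simp only [Set.mem_preimage, Set.mem_image, Set.mem_iUnion]
  constructor
  · rintro ⟨w, hw, h⟩
    obtain ⟨s, rfl⟩ := (ofTuple_eq_iff n v w).1 h.symm
    exact ⟨s, hw⟩
  · rintro ⟨s, hs⟩
    exact ⟨_, hs, ((ofTuple_eq_iff n v _).2 ⟨s, rfl⟩).symm⟩

theorem continuous_comp_perm {α : Type*} [TopologicalSpace α] {m : ℕ} (s : Equiv.Perm (Fin m)) :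
    Continuous fun v : Fin m → α => v ∘ s :=
  continuous_pi fun i => continuous_apply (s i)

theorem isOpenMap_ofTuple (n : ℕ) : IsOpenMap (ofTuple n) := by
  intro U hU
  rw [isOpen_coinduced, preimage_ofTuple_image]
  exact isOpen_iUnion fun s => hU.preimage (continuous_comp_perm s)

theorem isClosedMap_ofTuple (n : ℕ) : IsClosedMap (ofTuple n) := by
  intro U hU
  rw [isClosed_coinduced, preimage_ofTuple_image]
  exact isClosed_iUnion_of_finite fun s => hU.preimage (continuous_comp_perm s)

theorem finite_ofTuple_fiber (n : ℕ) (X : VSpace n) : (ofTuple n ⁻¹' {X}).Finite := by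
  obtain ⟨v, rfl⟩ := ofTuple_surjective n X
  refine (Set.finite_range fun s : Equiv.Perm (Fin (n - 1)) => v ∘ s).subset fun w hw => ?_
  obtain ⟨s, rfl⟩ := (ofTuple_eq_iff n v w).1 (Eq.symm hw)
  exact ⟨s, rfl⟩

/-- The inclusion of the tuples of nonzero numbers. -/
def tupleVal {m : ℕ} (v : Fin m → {z : ℂ // z ≠ 0}) (i : Fin m) : ℂ := v i

theorem isEmbedding_tupleVal (m : ℕ) : Topology.IsEmbedding (tupleVal (m := m)) :=
  Topology.IsEmbedding.piMap fun _ => Topology.IsEmbedding.subtypeVal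

theorem nodup_ofTuple_iff {n : ℕ} (v : Fin (n - 1) → {z : ℂ // z ≠ 0}) :
    (ofTuple n v).1.Nodup ↔ Function.Injective (tupleVal v) := by
  constructor
  · intro h i j hij
    have h' : (Finset.univ.val.map fun i => (v i : ℂ)).Nodup := h
    exact Multiset.inj_on_of_nodup_map h' i (Finset.mem_univ i) j (Finset.mem_univ j) hij
  · intro h
    exact Finset.univ.nodup.map h

theorem isClosed_repeatedLocus (n : ℕ) : IsClosed (repeatedLocus n) := by
  rw [← isOpen_compl_iff, isOpen_coinduced]
  have : ofTuple n ⁻¹' (repeatedLocus n)ᶜ = tupleVal ⁻¹' {v | Function.Injective v} := by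
    ext v
    simp [repeatedLocus, nodup_ofTuple_iff]
  rw [this]
  exact isOpen_setOf_injective.preimage (isEmbedding_tupleVal _).continuous

theorem isPreconnected_compl_repeatedLocus (n : ℕ) : IsPreconnected (repeatedLocus n)ᶜ := by
  have h : (repeatedLocus n)ᶜ = ofTuple n '' (tupleVal ⁻¹' {v | Function.Injective v}) := by
    ext X
    obtain ⟨v, rfl⟩ := ofTuple_surjective n X
    constructor
    · intro hX
      exact ⟨v, (nodup_ofTuple_iff v).1 (not_not.1 hX), rfl⟩
    · rintro ⟨w, hw, hwv⟩
      rw [← hwv]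
      exact not_not.2 ((nodup_ofTuple_iff w).2 hw)
  rw [h]
  refine IsPreconnected.image ?_ _ (continuous_ofTuple n).continuousOn
  rw [← (isEmbedding_tupleVal _).isPreconnected_image]
  convert isPreconnected_injective_ne_zero (ι := Fin (n - 1)) using 1
  ext v
  constructor
  · rintro ⟨w, hw, rfl⟩
    exact ⟨hw, fun i => (w i).2⟩
  · rintro ⟨hv, hv0⟩
    exact ⟨fun i => ⟨v i, hv0 i⟩, hv, rfl⟩

end VSpace

/-! ### Polynomials with distinct roots and their critical values -/

theorem DPol.coeff_injective (n : ℕ) :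
    Function.Injective fun (P : DPol n) (k : ℕ) => P.1.coeff k := fun _ _ h =>
  Subtype.ext (Polynomial.ext fun k => congrFun h k)

theorem DPol.isEmbedding_coeff (n : ℕ) :
    Topology.IsEmbedding fun (P : DPol n) (k : ℕ) => P.1.coeff k :=
  ⟨⟨rfl⟩, DPol.coeff_injective n⟩

instance (n : ℕ) : T2Space (DPol n) := (DPol.isEmbedding_coeff n).t2Space

section CriticalParametrization

variable {n : ℕ}

/-- The tuples whose centered polynomial has nonzero critical values. -/
def CritTuple (n : ℕ) : Type := {x : Fin (n - 1) → ℂ // ∀ i, critVal x i ≠ 0}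

noncomputable instance (n : ℕ) : TopologicalSpace (CritTuple n) := instTopologicalSpaceSubtype

/-- A multiple root is a critical point with critical value 0. -/
theorem CritTuple.nodup_roots (x : CritTuple n) : (centeredPoly x.1).roots.Nodup := by
  rw [Multiset.nodup_iff_count_le_one]
  intro z
  rw [count_roots]
  by_contra! h
  have hne := (centeredPoly_monic x.1).ne_zero
  obtain ⟨h1, h2⟩ := (one_lt_rootMultiplicity_iff_isRoot hne).1 h
  have hd : derivative (centeredPoly x.1) ≠ 0 := by
    rw [derivative_ne_zero, natDegree_centeredPoly]
    exact Nat.succ_ne_zero _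
  rw [← mem_roots hd, roots_derivative_centeredPoly, Multiset.mem_map] at h2
  obtain ⟨i, -, rfl⟩ := h2
  exact x.2 i h1

theorem card_fin_pred_add_one (h : Nonempty (Fin (n - 1))) : Fintype.card (Fin (n - 1)) + 1 = n := by
  obtain ⟨i⟩ := h
  have := i.2
  rw [Fintype.card_fin]
  omega

/-- The ordered nonzero critical values. -/
noncomputable def CritTuple.critVal (x : CritTuple n) (i : Fin (n - 1)) : {z : ℂ // z ≠ 0} :=
  ⟨_root_.critVal x.1 i, x.2 i⟩

/-- The action of a permutation on the critical points. -/
noncomputable def CritTuple.perm (s : Equiv.Perm (Fin (n - 1))) (x : CritTuple n) : CritTuple n :=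
  ⟨x.1 ∘ s, by rw [critVal_comp_perm]; exact fun i => x.2 (s i)⟩

theorem CritTuple.continuous_critVal : Continuous (CritTuple.critVal (n := n)) :=
  continuous_pi fun i => Continuous.subtype_mk
    (((continuous_apply i).comp _root_.continuous_critVal).comp continuous_subtype_val) _

/-- `CritTuple n` is the full preimage of the nonzero tuples, so openness, closedness and
surjectivity restrict to it. -/
theorem CritTuple.image_critVal (A : Set (Fin (n - 1) → ℂ)) :
    CritTuple.critVal (n := n) '' (Subtype.val ⁻¹' A) = VSpace.tupleVal ⁻¹' (_root_.critVal '' A) := by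
  ext v
  constructor
  · rintro ⟨x, hx, rfl⟩
    exact ⟨x.1, hx, rfl⟩
  · rintro ⟨x, hx, hxv⟩
    have h0 : ∀ i, _root_.critVal x i ≠ 0 := fun i => by rw [hxv]; exact (v i).2
    exact ⟨⟨x, h0⟩, hx, funext fun i => Subtype.ext (congrFun hxv i)⟩

/-! ### Descent from ordered tuples to polynomials and unordered critical values. -/

variable [hne : Nonempty (Fin (n - 1))]

/-- The polynomial with the critical points and the constant term given by a tuple. -/
noncomputable def DPol.ofCrit (x : CritTuple n) : DPol n :=
  ⟨centeredPoly x.1, centeredPoly_monic x.1,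
    (natDegree_centeredPoly x.1).trans (card_fin_pred_add_one hne), x.nodup_roots,
    sum_roots_centeredPoly x.1⟩

theorem criticalValues_ofCrit (x : CritTuple n) :
    criticalValues n (DPol.ofCrit x) = VSpace.ofTuple n x.critVal := by
  apply Subtype.ext
  change (derivative (centeredPoly x.1)).roots.map _ = _
  rw [roots_derivative_centeredPoly, Multiset.map_map]
  rfl

theorem exists_critTuple_centeredPoly_eq (P : DPol n) :
    ∃ x : Fin (n - 1) → ℂ, centeredPoly x = P.1 ∧ ∀ i, critVal x i ≠ 0 := by
  obtain ⟨x, hx⟩ := exists_centeredPoly_eq (ι := Fin (n - 1)) P.2.1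
    (P.2.2.1.trans (card_fin_pred_add_one hne).symm) P.2.2.2.2
  refine ⟨x, hx, fun i h => P.zero_notMem_criticalValues ?_⟩
  rw [← hx, roots_derivative_centeredPoly, Multiset.map_map, Multiset.mem_map]
  exact ⟨i, Finset.mem_univ i, h⟩

theorem DPol.ofCrit_surjective : Function.Surjective (DPol.ofCrit (n := n)) := by
  intro P
  obtain ⟨x, hx, h0⟩ := exists_critTuple_centeredPoly_eq P
  exact ⟨⟨x, h0⟩, Subtype.ext hx⟩

theorem DPol.continuous_ofCrit : Continuous (DPol.ofCrit (n := n)) := by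
  rw [(DPol.isEmbedding_coeff n).continuous_iff]
  exact continuous_pi fun k => (continuous_coeff_centeredPoly k).comp continuous_subtype_val

theorem DPol.isClosedMap_ofCrit : IsClosedMap (DPol.ofCrit (n := n)) := by
  intro A hA
  obtain ⟨A', hA', rfl⟩ := isClosed_induced_iff.1 hA
  have h := (isClosedMap_coeff_centeredPoly (ι := Fin (n - 1)) A' hA').preimage
    (DPol.isEmbedding_coeff n).continuous
  convert h using 1
  ext P
  constructor
  · rintro ⟨x, hx, rfl⟩
    exact ⟨x.1, hx, rfl⟩
  · rintro ⟨x, hx, hxP⟩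
    have hxP' : centeredPoly x = P.1 := Polynomial.ext fun k => congrFun hxP k
    have h0 : ∀ i, _root_.critVal x i ≠ 0 := by
      obtain ⟨y, hy, hy0⟩ := exists_critTuple_centeredPoly_eq P
      obtain ⟨s, rfl⟩ := exists_perm_of_centeredPoly_eq (hy.trans hxP'.symm)
      rw [critVal_comp_perm]
      exact fun i => hy0 (s i)
    exact ⟨⟨x, h0⟩, hx, Subtype.ext hxP'⟩

theorem DPol.isQuotientMap_ofCrit : Topology.IsQuotientMap (DPol.ofCrit (n := n)) :=
  DPol.isClosedMap_ofCrit.isQuotientMap DPol.continuous_ofCrit DPol.ofCrit_surjective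

theorem DPol.isOpenMap_ofCrit : IsOpenMap (DPol.ofCrit (n := n)) := by
  intro U hU
  rw [← DPol.isQuotientMap_ofCrit.isOpen_preimage]
  have h : DPol.ofCrit ⁻¹' (DPol.ofCrit '' U) =
      ⋃ s : Equiv.Perm (Fin (n - 1)), CritTuple.perm s ⁻¹' U := by
    ext x
    simp only [Set.mem_preimage, Set.mem_image, Set.mem_iUnion]
    constructor
    · rintro ⟨y, hy, h⟩
      obtain ⟨s, hs⟩ := exists_perm_of_centeredPoly_eq (congrArg Subtype.val h.symm)
      refine ⟨s, ?_⟩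
      rwa [show CritTuple.perm s x = y from Subtype.ext hs.symm]
    · rintro ⟨s, hs⟩
      exact ⟨_, hs, Subtype.ext (centeredPoly_comp_perm x.1 s)⟩
  rw [h]
  refine isOpen_iUnion fun s => hU.preimage ?_
  exact Continuous.subtype_mk ((VSpace.continuous_comp_perm s).comp continuous_subtype_val) _

theorem CritTuple.isOpenMap_critVal : IsOpenMap (CritTuple.critVal (n := n)) := by
  intro U hU
  obtain ⟨U', hU', rfl⟩ := isOpen_induced_iff.1 hU
  rw [CritTuple.image_critVal]
  exact (_root_.isOpenMap_critVal U' hU').preimage (VSpace.isEmbedding_tupleVal _).continuous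

theorem CritTuple.isClosedMap_critVal : IsClosedMap (CritTuple.critVal (n := n)) := by
  intro U hU
  obtain ⟨U', hU', rfl⟩ := isClosed_induced_iff.1 hU
  rw [CritTuple.image_critVal]
  exact (isProperMap_critVal.isClosedMap U' hU').preimage (VSpace.isEmbedding_tupleVal _).continuous

theorem CritTuple.surjective_critVal : Function.Surjective (CritTuple.critVal (n := n)) := by
  intro v
  obtain ⟨x, hx⟩ := _root_.surjective_critVal (VSpace.tupleVal v)
  have h : v ∈ CritTuple.critVal (n := n) '' (Subtype.val ⁻¹' {x}) := by
    rw [CritTuple.image_critVal]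
    exact ⟨x, rfl, hx⟩
  obtain ⟨y, -, hy⟩ := h
  exact ⟨y, hy⟩

theorem CritTuple.finite_critVal_fiber (v : Fin (n - 1) → {z : ℂ // z ≠ 0}) :
    (CritTuple.critVal (n := n) ⁻¹' {v}).Finite := by
  refine Set.Finite.of_finite_image ((_root_.finite_critVal_fiber (VSpace.tupleVal v)).subset ?_)
    (Subtype.val_injective.injOn)
  rintro _ ⟨x, hx, rfl⟩
  exact congrArg VSpace.tupleVal hx

/-- Reduces openness and closedness of ν to the ordered map, through the commutative square of
`criticalValues_ofCrit`. -/
theorem criticalValues_image (U : Set (DPol n)) :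
    criticalValues n '' U = VSpace.ofTuple n '' (CritTuple.critVal '' (DPol.ofCrit ⁻¹' U)) := by
  rw [← Set.image_preimage_eq U DPol.ofCrit_surjective]
  simp only [Set.image_image, criticalValues_ofCrit]
  rw [Set.image_preimage_eq U DPol.ofCrit_surjective]

theorem continuous_criticalValues : Continuous (criticalValues n) := by
  rw [DPol.isQuotientMap_ofCrit.continuous_iff]
  have : criticalValues n ∘ DPol.ofCrit = VSpace.ofTuple n ∘ CritTuple.critVal :=
    funext criticalValues_ofCrit
  rw [this]
  exact (VSpace.continuous_ofTuple n).comp CritTuple.continuous_critVal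

theorem isOpenMap_criticalValues : IsOpenMap (criticalValues n) := by
  intro U hU
  rw [criticalValues_image]
  exact VSpace.isOpenMap_ofTuple n _ (CritTuple.isOpenMap_critVal _ (hU.preimage DPol.continuous_ofCrit))

theorem isClosedMap_criticalValues : IsClosedMap (criticalValues n) := by
  intro U hU
  rw [criticalValues_image]
  exact VSpace.isClosedMap_ofTuple n _
    (CritTuple.isClosedMap_critVal _ (hU.preimage DPol.continuous_ofCrit))

theorem surjective_criticalValues : Function.Surjective (criticalValues n) := by
  intro X
  obtain ⟨v, rfl⟩ := VSpace.ofTuple_surjective n X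
  obtain ⟨x, rfl⟩ := CritTuple.surjective_critVal v
  exact ⟨_, criticalValues_ofCrit x⟩

theorem finite_criticalValues_fiber (X : VSpace n) : (criticalValues n ⁻¹' {X}).Finite := by
  refine (((VSpace.finite_ofTuple_fiber n X).preimage' fun v _ =>
    CritTuple.finite_critVal_fiber v).image DPol.ofCrit).subset fun P hP => ?_
  obtain ⟨x, rfl⟩ := DPol.ofCrit_surjective P
  exact ⟨x, (criticalValues_ofCrit x).symm.trans hP, rfl⟩

theorem exists_injOn_criticalValues {P : DPol n} (hP : criticalValues n P ∉ repeatedLocus n) :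
    ∃ U ∈ nhds P, Set.InjOn (criticalValues n) U := by
  obtain ⟨x, rfl⟩ := DPol.ofCrit_surjective P
  rw [criticalValues_ofCrit] at hP
  have hinj : Function.Injective (critVal x.1) := (VSpace.nodup_ofTuple_iff _).1 (not_not.1 hP)
  obtain ⟨N, hN, hNi⟩ := exists_injOn_critVal (injective_of_injective_critVal hinj)
  -- The entries of `critVal x.1` are distinct, so a nontrivial permutation moves this tuple, and by
  -- continuity no two tuples near it differ by that permutation. Hence nearby ordered tuples with
  -- the same unordered tuple are equal.
  have hsep : ∀ᶠ p : (Fin (n - 1) → ℂ) × (Fin (n - 1) → ℂ) in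
      nhds (critVal x.1) ×ˢ nhds (critVal x.1), ∀ s : Equiv.Perm (Fin (n - 1)),
        p.2 = p.1 ∘ s → p.1 = p.2 := by
    rw [Filter.eventually_all]
    intro s
    by_cases hs : s = 1
    · subst hs
      exact Filter.Eventually.of_forall fun p hp => hp.symm
    · have hne : critVal x.1 ≠ critVal x.1 ∘ s := by
        intro h
        apply hs
        ext1 i
        exact (hinj (congrFun h i)).symm
      have hop : IsOpen {p : (Fin (n - 1) → ℂ) × (Fin (n - 1) → ℂ) | p.2 ≠ p.1 ∘ s} :=
        isOpen_ne_fun continuous_snd ((VSpace.continuous_comp_perm s).comp continuous_fst)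
      rw [← nhds_prod_eq]
      filter_upwards [hop.mem_nhds (show ((critVal x.1), (critVal x.1)) ∈ _ from hne)] with p hp hp'
      exact absurd hp' hp
  obtain ⟨W, hW, hWs⟩ := Filter.eventually_prod_self_iff'.1 hsep
  let U : Set (CritTuple n) := Subtype.val ⁻¹' (N ∩ critVal ⁻¹' W)
  have hU : U ∈ nhds x := by
    refine (continuous_subtype_val (p := fun x : Fin (n - 1) → ℂ => ∀ i, critVal x i ≠ 0)).continuousAt.preimage_mem_nhds ?_
    exact Filter.inter_mem hN (continuous_critVal.continuousAt.preimage_mem_nhds hW)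
  refine ⟨DPol.ofCrit '' U, DPol.isOpenMap_ofCrit.image_mem_nhds hU, ?_⟩
  rintro _ ⟨y, hy, rfl⟩ _ ⟨z, hz, rfl⟩ hyz
  rw [criticalValues_ofCrit, criticalValues_ofCrit] at hyz
  obtain ⟨s, hs⟩ := (VSpace.ofTuple_eq_iff n _ _).1 hyz
  have hs' : critVal z.1 = critVal y.1 ∘ s := congrArg VSpace.tupleVal hs
  have := hNi hy.1 hz.1 (hWs _ hy.2 _ hz.2 s hs')
  rw [show y = z from Subtype.ext this]

/-- A closed local homeomorphism with finite fibres evenly covers the base. -/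
theorem isCoveringMapOn_criticalValues : IsCoveringMapOn (criticalValues n) (repeatedLocus n)ᶜ :=
  isClosedMap_criticalValues.isCoveringMapOn_of_isLocalHomeomorphOn
    (fun X _ => finite_criticalValues_fiber X)
    (isOpenMap_criticalValues.isLocalHomeomorphOn_of_injOn continuous_criticalValues
      fun _ hP => exists_injOn_criticalValues hP)

theorem exists_degree_criticalValues :
    ∃ d : ℕ, ∀ X ∉ repeatedLocus n, (criticalValues n ⁻¹' {X}).ncard = d := by
  rcases (repeatedLocus n)ᶜ.eq_empty_or_nonempty with h | ⟨X₀, hX₀⟩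
  · exact ⟨0, fun X hX => absurd (show X ∈ (repeatedLocus n)ᶜ from hX) (by simp [h])⟩
  · exact ⟨_, fun X hX => isCoveringMapOn_criticalValues.ncard_fiber_eq
      (VSpace.isPreconnected_compl_repeatedLocus n) surjective_criticalValues hX hX₀⟩

end CriticalParametrization

/-! ### Sectors -/

namespace Sector

theorem exists_mem_region {z : ℂ} (hz : z ≠ 0) : ∃ s : Sector, z ∈ s.region := by
  rcases lt_trichotomy z.re 0 with hr | hr | hr <;> rcases lt_trichotomy z.im 0 with hi | hi | hi
  · exact ⟨.quadrantC, hr, hi⟩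
  · exact ⟨.realNeg, hr, hi⟩
  · exact ⟨.quadrantB, hr, hi⟩
  · exact ⟨.imagNeg, hr, hi⟩
  · exact absurd (Complex.ext hr hi) hz
  · exact ⟨.imagPos, hr, hi⟩
  · exact ⟨.quadrantD, hr, hi⟩
  · exact ⟨.realPos, hr, hi⟩
  · exact ⟨.quadrantA, hr, hi⟩

theorem eq_of_mem_region {z : ℂ} {s t : Sector} (hs : z ∈ s.region) (ht : z ∈ t.region) : s = t := by
  cases s <;> cases t <;> first
    | rfl
    | (exfalso
       simp only [region, Set.mem_ofPred_eq] at hs ht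
       obtain ⟨h1, h2⟩ := hs
       obtain ⟨h3, h4⟩ := ht
       linarith)

/-- A point in each sector. -/
def point : Sector → ℂ
  | .quadrantA => ⟨1, 1⟩
  | .quadrantB => ⟨-1, 1⟩
  | .quadrantC => ⟨-1, -1⟩
  | .quadrantD => ⟨1, -1⟩
  | .realPos => ⟨1, 0⟩
  | .realNeg => ⟨-1, 0⟩
  | .imagPos => ⟨0, 1⟩
  | .imagNeg => ⟨0, -1⟩

theorem point_mem_region (s : Sector) : s.point ∈ s.region := by
  cases s <;> simp [point, region]

theorem zero_notMem_region (s : Sector) : (0 : ℂ) ∉ s.region := by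
  cases s <;> simp [region]

theorem point_mem_region_iff {s t : Sector} : s.point ∈ t.region ↔ s = t :=
  ⟨fun h => eq_of_mem_region s.point_mem_region h, fun h => h ▸ s.point_mem_region⟩

/-- The sector of a nonzero number. -/
noncomputable def ofNonzero (z : {z : ℂ // z ≠ 0}) : Sector := (exists_mem_region z.2).choose

theorem mem_region_iff (z : {z : ℂ // z ≠ 0}) (s : Sector) : z.1 ∈ s.region ↔ ofNonzero z = s :=
  ⟨fun h => eq_of_mem_region (exists_mem_region z.2).choose_spec h,
    fun h => h ▸ (exists_mem_region z.2).choose_spec⟩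

/-- Independent rescaling of the real and the imaginary part. -/
def rescale (α β : ℝ) (z : ℂ) : ℂ := ⟨α * z.re, β * z.im⟩

theorem continuous_rescale (α β : ℝ) : Continuous (rescale α β) := by
  have : rescale α β = fun z => ((α * z.re : ℝ) : ℂ) + (β * z.im : ℝ) * Complex.I := by
    funext z; exact Complex.mk_eq_add_mul_I _ _
  rw [this]
  fun_prop

theorem rescale_mem_region {α β : ℝ} (hα : 0 < α) (hβ : 0 < β) {z : ℂ} {s : Sector}
    (hz : z ∈ s.region) : rescale α β z ∈ s.region := by
  cases s <;> simp only [region, rescale, Set.mem_ofPred_eq] at hz ⊢ <;>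
    obtain ⟨h1, h2⟩ := hz <;> simp_all [mul_neg_iff]

theorem rescale_ne_zero {α β : ℝ} (hα : 0 < α) (hβ : 0 < β) {z : ℂ} (hz : z ≠ 0) :
    rescale α β z ≠ 0 := by
  obtain ⟨s, hs⟩ := exists_mem_region hz
  intro h
  have := rescale_mem_region hα hβ hs
  rw [h] at this
  exact s.zero_notMem_region this

theorem exists_pos_mul_eq {a b : ℝ} (h : (0 < a ∧ 0 < b) ∨ (a < 0 ∧ b < 0) ∨ (a = 0 ∧ b = 0)) :
    ∃ α : ℝ, 0 < α ∧ α * a = b := by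
  rcases h with ⟨ha, hb⟩ | ⟨ha, hb⟩ | ⟨rfl, rfl⟩
  · exact ⟨b / a, div_pos hb ha, div_mul_cancel₀ _ ha.ne'⟩
  · exact ⟨b / a, div_pos_of_neg_of_neg hb ha, div_mul_cancel₀ _ ha.ne⟩
  · exact ⟨1, one_pos, by simp⟩

/-- Two points of one sector have real parts of equal sign, and likewise imaginary parts; a
vanishing part is rescaled by 1. -/
theorem exists_rescale_eq {z w : ℂ} {s : Sector} (hz : z ∈ s.region) (hw : w ∈ s.region) :
    ∃ α β : ℝ, 0 < α ∧ 0 < β ∧ rescale α β z = w := by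
  have h : (∃ α : ℝ, 0 < α ∧ α * z.re = w.re) ∧ ∃ β : ℝ, 0 < β ∧ β * z.im = w.im := by
    cases s <;> simp only [region, Set.mem_ofPred_eq] at hz hw <;>
      exact ⟨exists_pos_mul_eq (by tauto), exists_pos_mul_eq (by tauto)⟩
  obtain ⟨⟨α, hα, h1⟩, β, hβ, h2⟩ := h
  exact ⟨α, β, hα, hβ, Complex.ext h1 h2⟩

/-- The open sectors. -/
def IsQuadrant (s : Sector) : Prop :=
  s = .quadrantA ∨ s = .quadrantB ∨ s = .quadrantC ∨ s = .quadrantD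

theorem isOpen_region {s : Sector} (hs : s.IsQuadrant) : IsOpen s.region := by
  have hre := Complex.continuous_re
  have him := Complex.continuous_im
  rcases hs with rfl | rfl | rfl | rfl
  · exact (isOpen_lt continuous_const hre).inter (isOpen_lt continuous_const him)
  · exact (isOpen_lt hre continuous_const).inter (isOpen_lt continuous_const him)
  · exact (isOpen_lt hre continuous_const).inter (isOpen_lt him continuous_const)
  · exact (isOpen_lt continuous_const hre).inter (isOpen_lt him continuous_const)

/-- The semi-axes are closed in the punctured plane, which is where the tuples live. -/
theorem isClosed_insert_zero_region {s : Sector} (hs : ¬ s.IsQuadrant) :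
    IsClosed (insert 0 s.region) := by
  have h : insert 0 s.region = {z : ℂ | (s = .realPos → 0 ≤ z.re ∧ z.im = 0) ∧
      (s = .realNeg → z.re ≤ 0 ∧ z.im = 0) ∧ (s = .imagPos → z.re = 0 ∧ 0 ≤ z.im) ∧
      (s = .imagNeg → z.re = 0 ∧ z.im ≤ 0)} := by
    ext z
    cases s <;> simp_all [IsQuadrant, region, Complex.ext_iff, le_iff_lt_or_eq] <;> grind
  rw [h]
  cases s <;> simp_all [IsQuadrant]
  · exact (isClosed_le continuous_const Complex.continuous_re).inter
      (isClosed_eq Complex.continuous_im continuous_const)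
  · exact (isClosed_le Complex.continuous_re continuous_const).inter
      (isClosed_eq Complex.continuous_im continuous_const)
  · exact (isClosed_eq Complex.continuous_re continuous_const).inter
      (isClosed_le continuous_const Complex.continuous_im)
  · exact (isClosed_eq Complex.continuous_re continuous_const).inter
      (isClosed_le Complex.continuous_im continuous_const)

end Sector

/-! ### The stratification -/

section Strata

variable {n : ℕ}

open Classical in
theorem VSpace.countP_ofTuple (v : Fin (n - 1) → {z : ℂ // z ≠ 0}) (O : Set ℂ) :
    (VSpace.ofTuple n v).1.countP (· ∈ O) = (Finset.univ.filter fun i => (v i : ℂ) ∈ O).card := by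
  change (Finset.univ.val.map fun i => (v i : ℂ)).countP (· ∈ O) = _
  rw [Multiset.countP_map]
  rfl

theorem sigmaSequence_ofTuple (v : Fin (n - 1) → {z : ℂ // z ≠ 0}) (s : Sector) :
    sigmaSequence (VSpace.ofTuple n v) s =
      (Finset.univ.val.map fun i => Sector.ofNonzero (v i)).count s := by
  classical
  rw [sigmaSequence, VSpace.countP_ofTuple, Multiset.count_map]
  simp only [Sector.mem_region_iff, eq_comm (b := s)]
  rfl

theorem sigmaSequence_ofTuple_congr {v w : Fin (n - 1) → {z : ℂ // z ≠ 0}}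
    (h : ∀ i, Sector.ofNonzero (v i) = Sector.ofNonzero (w i)) :
    sigmaSequence (VSpace.ofTuple n v) = sigmaSequence (VSpace.ofTuple n w) := by
  funext s
  rw [sigmaSequence_ofTuple, sigmaSequence_ofTuple, funext h]

theorem exists_perm_of_sigmaSequence_eq {v w : Fin (n - 1) → {z : ℂ // z ≠ 0}}
    (h : sigmaSequence (VSpace.ofTuple n v) = sigmaSequence (VSpace.ofTuple n w)) :
    ∃ s : Equiv.Perm (Fin (n - 1)), ∀ i, Sector.ofNonzero (w i) = Sector.ofNonzero (v (s i)) := by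
  have h' : Finset.univ.val.map (fun i => Sector.ofNonzero (v i)) =
      Finset.univ.val.map fun i => Sector.ofNonzero (w i) := by
    ext s
    rw [← sigmaSequence_ofTuple, h, sigmaSequence_ofTuple]
  obtain ⟨s, hs⟩ := Multiset.exists_perm_of_map_univ_eq h'
  exact ⟨s, fun i => congrFun hs i⟩

theorem sum_sigmaSequence (X : VSpace n) : ∑ s, sigmaSequence X s = n - 1 := by
  obtain ⟨v, rfl⟩ := VSpace.ofTuple_surjective n X
  simp only [sigmaSequence_ofTuple]
  rw [Multiset.sum_count_eq_card fun _ _ => Finset.mem_univ _]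
  simp

theorem stratum_nonempty (a : SigmaIndex n) : (stratum n a).Nonempty := by
  classical
  let X : Multiset ℂ := ∑ s, Multiset.replicate (a.1 s) s.point
  have hcard : X.card = n - 1 := by
    rw [Multiset.card_sum]
    simpa using a.2
  have h0 : (0 : ℂ) ∉ X := by
    simp only [X, Multiset.mem_sum, not_exists, not_and]
    intro s _ h
    have h1 := s.point_mem_region
    rw [← Multiset.eq_of_mem_replicate h] at h1
    exact s.zero_notMem_region h1
  refine ⟨⟨X, hcard, h0⟩, ?_⟩
  funext t
  change X.countP (· ∈ t.region) = a.1 t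
  have h1 : X.countP (· ∈ t.region) =
      ∑ s, (Multiset.replicate (a.1 s) s.point).countP (· ∈ t.region) := by
    change Multiset.countPAddMonoidHom (· ∈ t.region) X = _
    rw [map_sum]
    rfl
  rw [h1, Finset.sum_eq_single t]
  · rw [Multiset.countP_eq_card.2, Multiset.card_replicate]
    intro z hz
    rw [Multiset.eq_of_mem_replicate hz]
    exact t.point_mem_region
  · intro s _ hst
    rw [Multiset.countP_eq_zero]
    intro z hz hzt
    rw [Multiset.eq_of_mem_replicate hz, Sector.point_mem_region_iff] at hzt
    exact hst hzt
  · simp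

instance (n : ℕ) : Finite (SigmaIndex n) := by
  refine Finite.of_injective
    (fun (a : SigmaIndex n) (s : Sector) => (⟨a.1 s, Nat.lt_succ_of_le ?_⟩ : Fin (n - 1 + 1))) ?_
  · exact (Finset.single_le_sum (fun _ _ => Nat.zero_le _) (Finset.mem_univ s)).trans_eq a.2
  · intro a b h
    exact Subtype.ext (funext fun s => congrArg Fin.val (congrFun h s))

open Classical in
theorem isOpen_le_countP {O : Set ℂ} (hO : IsOpen O) (k : ℕ) :
    IsOpen {X : VSpace n | k ≤ X.1.countP (· ∈ O)} := by
  rw [isOpen_coinduced]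
  have h : VSpace.ofTuple n ⁻¹' {X : VSpace n | k ≤ X.1.countP (· ∈ O)} =
      ⋃ T : {T : Finset (Fin (n - 1)) // k ≤ T.card}, ⋂ i : T.1, {v | (v i.1 : ℂ) ∈ O} := by
    ext v
    simp only [Set.mem_preimage, Set.mem_ofPred_eq, VSpace.countP_ofTuple, Set.mem_iUnion,
      Set.mem_iInter]
    constructor
    · intro hk
      exact ⟨⟨_, hk⟩, fun i => (Finset.mem_filter.1 i.2).2⟩
    · rintro ⟨⟨T, hT⟩, h⟩
      exact hT.trans (Finset.card_le_card fun i hi =>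
        Finset.mem_filter.2 ⟨Finset.mem_univ i, h ⟨i, hi⟩⟩)
  rw [h]
  exact isOpen_iUnion fun T => isOpen_iInter_of_finite fun i =>
    hO.preimage (continuous_subtype_val.comp (continuous_apply i.1))

theorem isClosed_sigmaSequence_le {s : Sector} (hs : s.IsQuadrant) (k : ℕ) :
    IsClosed {X : VSpace n | sigmaSequence X s ≤ k} := by
  rw [← isOpen_compl_iff]
  have h : {X : VSpace n | sigmaSequence X s ≤ k}ᶜ = {X | k + 1 ≤ sigmaSequence X s} := by
    ext X
    exact not_le (a := sigmaSequence X s) (b := k)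
  rw [h]
  exact isOpen_le_countP (Sector.isOpen_region hs) (k + 1)

theorem isOpen_sigmaSequence_le {s : Sector} (hs : ¬ s.IsQuadrant) (k : ℕ) :
    IsOpen {X : VSpace n | sigmaSequence X s ≤ k} := by
  classical
  obtain ⟨O, hO⟩ : ∃ O, O = (insert 0 s.region)ᶜ := ⟨_, rfl⟩
  have hop : IsOpen O := hO ▸ (Sector.isClosed_insert_zero_region hs).isOpen_compl
  -- At most `k` points on the semi-axis means at least `n - 1 - k` off it; when the subtraction
  -- truncates, both conditions hold trivially.
  convert isOpen_le_countP (n := n) hop (n - 1 - k) using 1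
  ext X
  have h1 : X.1.countP (· ∈ O) = X.1.countP fun z => ¬ z ∈ s.region := by
    refine Multiset.countP_congr rfl fun z hz => ?_
    have : z ≠ 0 := fun h => X.2.2 (h ▸ hz)
    simp [hO, this]
  have h2 := Multiset.card_eq_countP_add_countP (· ∈ s.region) X.1
  rw [X.2.1, ← h1] at h2
  have h3 : sigmaSequence X s = X.1.countP (· ∈ s.region) := rfl
  simp only [Set.mem_ofPred_eq, h3]
  omega

theorem isLocallyClosed_stratum (a : SigmaIndex n) : IsLocallyClosed (stratum n a) := by
  -- As the total is fixed at `n - 1`, upper bounds on all eight counts force equality. Such a bound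
  -- is an open condition for a semi-axis and a closed one for a quadrant.
  have h : stratum n a =
      (⋂ s : {s : Sector // ¬ s.IsQuadrant}, {X : VSpace n | sigmaSequence X s.1 ≤ a.1 s.1}) ∩
      ⋂ s : {s : Sector // s.IsQuadrant}, {X : VSpace n | sigmaSequence X s.1 ≤ a.1 s.1} := by
    ext X
    simp only [Set.mem_inter_iff, Set.mem_iInter, Set.mem_ofPred_eq]
    constructor
    · intro hX
      have hX' : sigmaSequence X = a.1 := hX
      simp [hX']
    · rintro ⟨h1, h2⟩
      have hle : ∀ s ∈ Finset.univ, sigmaSequence X s ≤ a.1 s := by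
        intro s _
        by_cases hs : s.IsQuadrant
        · exact h2 ⟨s, hs⟩
        · exact h1 ⟨s, hs⟩
      have := (Finset.sum_eq_sum_iff_of_le hle).1 ((sum_sigmaSequence X).trans a.2.symm)
      exact funext fun s => this s (Finset.mem_univ s)
  rw [h]
  exact (isOpen_iInter_of_finite fun s => isOpen_sigmaSequence_le s.2 _).isLocallyClosed.inter
    (isClosed_iInter fun s => isClosed_sigmaSequence_le s.2 _).isLocallyClosed

theorem stratum_subset_closure {a b : SigmaIndex n}
    (h : (stratum n a ∩ closure (stratum n b)).Nonempty) : stratum n a ⊆ closure (stratum n b) := by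
  obtain ⟨X, hXa, hXb⟩ := h
  intro Y hY
  obtain ⟨v, rfl⟩ := VSpace.ofTuple_surjective n X
  obtain ⟨w, rfl⟩ := VSpace.ofTuple_surjective n Y
  obtain ⟨s, hs⟩ := exists_perm_of_sigmaSequence_eq (Eq.trans hXa (Eq.symm hY))
  have hv : VSpace.ofTuple n v = VSpace.ofTuple n (v ∘ s) :=
    (VSpace.ofTuple_eq_iff n _ _).2 ⟨s, rfl⟩
  rw [hv] at hXb
  have hscale : ∀ i, ∃ α β : ℝ, 0 < α ∧ 0 < β ∧ Sector.rescale α β (v (s i)) = w i := fun i =>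
    Sector.exists_rescale_eq ((Sector.mem_region_iff (v (s i)) _).2 rfl)
      ((Sector.mem_region_iff (w i) _).2 (hs i))
  choose α β hα hβ hαβ using hscale
  -- Rescaling entry by entry carries the reordered `v` to `w`. It preserves sectors at every tuple,
  -- not only near `v`, hence maps the preimage of `stratum n b` into itself and its closure into
  -- its closure.
  let g : (Fin (n - 1) → {z : ℂ // z ≠ 0}) → Fin (n - 1) → {z : ℂ // z ≠ 0} := fun u i =>
    ⟨Sector.rescale (α i) (β i) (u i), Sector.rescale_ne_zero (hα i) (hβ i) (u i).2⟩
  have hg : Continuous g := continuous_pi fun i => Continuous.subtype_mk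
    ((Sector.continuous_rescale _ _).comp (continuous_subtype_val.comp (continuous_apply i))) _
  have hgv : g (v ∘ s) = w := funext fun i => Subtype.ext (hαβ i)
  have hmaps : Set.MapsTo g (VSpace.ofTuple n ⁻¹' stratum n b) (VSpace.ofTuple n ⁻¹' stratum n b) := by
    intro u hu
    refine Eq.trans (sigmaSequence_ofTuple_congr fun i => ?_) hu
    rw [← Sector.mem_region_iff]
    exact Sector.rescale_mem_region (hα i) (hβ i) ((Sector.mem_region_iff (u i) _).2 rfl)
  have hcl := (VSpace.isOpenMap_ofTuple n).preimage_closure_eq_closure_preimage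
    (VSpace.continuous_ofTuple n) (stratum n b)
  have h1 : v ∘ s ∈ closure (VSpace.ofTuple n ⁻¹' stratum n b) := by
    rw [← hcl]; exact hXb
  have h2 := map_mem_closure hg h1 hmaps
  rw [hgv, ← hcl] at h2
  exact h2

theorem isStratification_stratum (n : ℕ) : IsStratification (stratum n) where
  nonempty := stratum_nonempty
  disjoint a b hab := Set.disjoint_left.2 fun X hX hX' => hab (Subtype.ext (Eq.trans (Eq.symm hX) hX'))
  cover := Set.eq_univ_of_forall fun X => Set.mem_iUnion.2 ⟨⟨sigmaSequence X, sum_sigmaSequence X⟩, rfl⟩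
  locallyFinite := locallyFinite_of_finite _
  locallyClosed := isLocallyClosed_stratum
  frontier a b := by
    refine ⟨stratum_subset_closure, fun h => ?_⟩
    obtain ⟨X, hX⟩ := stratum_nonempty a
    exact ⟨X, hX, h hX⟩

/-- Every tuple is a limit of tuples without repetitions in the same stratum. -/
theorem exists_tendsto_notMem_repeatedLocus (X : VSpace n) :
    ∃ γ : ℝ → VSpace n, Filter.Tendsto γ (nhdsWithin 0 (Set.Ioi 0)) (nhds X) ∧
      (∀ t, sigmaSequence (γ t) = sigmaSequence X) ∧
      ∀ᶠ t in nhdsWithin 0 (Set.Ioi 0), γ t ∉ repeatedLocus n := by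
  obtain ⟨v, rfl⟩ := VSpace.ofTuple_surjective n X
  have hpos : ∀ (t : ℝ) (i : Fin (n - 1)), 0 < 1 + |t| * (i : ℝ) := fun t i => by positivity
  -- Entry `i` is stretched by `1 + |t| * i`: the absolute value keeps the factor positive for all
  -- `t`, and equal nonzero entries with different indices separate as soon as `t > 0`.
  let γ : ℝ → Fin (n - 1) → {z : ℂ // z ≠ 0} := fun t i =>
    ⟨Sector.rescale (1 + |t| * i) (1 + |t| * i) (v i),
      Sector.rescale_ne_zero (hpos t i) (hpos t i) (v i).2⟩
  have hval : ∀ t i, (γ t i : ℂ) = v i + ((|t| : ℝ) : ℂ) * ((i : ℕ) * v i) := by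
    intro t i
    apply Complex.ext <;> simp [γ, Sector.rescale] <;> ring
  have hγ : Continuous γ := continuous_pi fun i => by
    rw [continuous_induced_rng]
    have : Subtype.val ∘ (fun t => γ t i) = fun t => (v i : ℂ) + ((|t| : ℝ) : ℂ) * ((i : ℕ) * v i) :=
      funext fun t => hval t i
    rw [this]
    fun_prop
  have hγ0 : γ 0 = v := funext fun i => Subtype.ext (by rw [hval]; simp)
  refine ⟨fun t => VSpace.ofTuple n (γ t), ?_, fun t => sigmaSequence_ofTuple_congr fun i => ?_, ?_⟩
  · have := ((VSpace.continuous_ofTuple n).comp hγ).tendsto 0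
    simp only [Function.comp_apply, hγ0] at this
    exact this.mono_left nhdsWithin_le_nhds
  · rw [← Sector.mem_region_iff]
    exact Sector.rescale_mem_region (hpos t i) (hpos t i) ((Sector.mem_region_iff (v i) _).2 rfl)
  · have h := eventually_injective_add_smul (v := VSpace.tupleVal v)
      (w := fun i => (i : ℕ) * (v i : ℂ)) (by
        intro i j hij hv h
        have hv' : (v i : ℂ) = v j := hv
        rw [hv'] at h
        have h1 := mul_right_cancel₀ (v j).2 h
        exact hij (Fin.ext (Nat.cast_injective h1)))
    filter_upwards [h, self_mem_nhdsWithin] with t ht ht0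
    rw [repeatedLocus, Set.mem_ofPred_eq, not_not, VSpace.nodup_ofTuple_iff]
    convert ht using 1
    funext i
    rw [VSpace.tupleVal, hval, abs_of_pos ht0]
    rfl

theorem isNowhereDense_repeatedLocus : IsNowhereDense (repeatedLocus n) := by
  rw [(VSpace.isClosed_repeatedLocus n).isNowhereDense_iff, ← Set.subset_empty_iff]
  intro X hX
  obtain ⟨γ, hγ, -, hγr⟩ := exists_tendsto_notMem_repeatedLocus X
  obtain ⟨t, ht, ht'⟩ := (hγr.and (hγ.eventually (mem_interior_iff_mem_nhds.1 hX))).exists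
  exact ht ht'

theorem isNowhereDense_repeatedLocus_stratum (a : SigmaIndex n) :
    IsNowhereDense (Subtype.val ⁻¹' repeatedLocus n : Set (stratum n a)) := by
  rw [((VSpace.isClosed_repeatedLocus n).preimage continuous_subtype_val).isNowhereDense_iff,
    ← Set.subset_empty_iff]
  rintro ⟨X, hXa⟩ hX
  obtain ⟨γ, hγ, hγa, hγr⟩ := exists_tendsto_notMem_repeatedLocus X
  let γ' : ℝ → stratum n a := fun t => ⟨γ t, (hγa t).trans hXa⟩
  have hγ' : Filter.Tendsto γ' (nhdsWithin 0 (Set.Ioi 0)) (nhds ⟨X, hXa⟩) := tendsto_subtype_rng.2 hγ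
  obtain ⟨t, ht, ht'⟩ := (hγr.and (hγ'.eventually (mem_interior_iff_mem_nhds.1 hX))).exists
  exact ht ht'

end Strata

/-! ### The ramified covers -/

theorem IsNowhereDense.preimage_of_isOpenMap {X Y : Type*} [TopologicalSpace X]
    [TopologicalSpace Y] {f : X → Y} (hf : Continuous f) (ho : IsOpenMap f) {B : Set Y}
    (hB : IsNowhereDense B) : IsNowhereDense (f ⁻¹' B) := by
  rw [IsNowhereDense, ← ho.preimage_closure_eq_closure_preimage hf,
    ← ho.preimage_interior_eq_interior_preimage hf, hB, Set.preimage_empty]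

theorem isFiniteRamifiedCover_criticalValues {n : ℕ} [Nonempty (Fin (n - 1))] :
    IsFiniteRamifiedCover (criticalValues n) (repeatedLocus n) where
  continuous := continuous_criticalValues
  isOpenMap := isOpenMap_criticalValues
  isClosedMap := isClosedMap_criticalValues
  surjective := surjective_criticalValues
  finite_fiber := finite_criticalValues_fiber
  isClosed_branch := VSpace.isClosed_repeatedLocus n
  nowhereDense_branch := isNowhereDense_repeatedLocus
  nowhereDense_preimage := isNowhereDense_repeatedLocus.preimage_of_isOpenMap
    continuous_criticalValues isOpenMap_criticalValues
  isCoveringMapOn := isCoveringMapOn_criticalValues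
  exists_degree := exists_degree_criticalValues

theorem Set.image_val_restrictPreimage_fiber {X Y : Type*} (f : X → Y) (S : Set Y) (y : S) :
    Subtype.val '' (S.restrictPreimage f ⁻¹' {y}) = f ⁻¹' {y.1} := by
  ext x
  constructor
  · rintro ⟨z, hz, rfl⟩
    exact congrArg Subtype.val hz
  · intro hx
    have hx' : f x = y := hx
    exact ⟨⟨x, by rw [Set.mem_preimage, hx']; exact y.2⟩, Subtype.ext hx', rfl⟩

/-- Every property of a ramified cover passes to the part over `S` except that `B` may fill an open
piece of `S`; this is the content of `hS`. Openness of the map then handles the preimage. -/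
theorem IsFiniteRamifiedCover.restrictPreimage {X Y : Type*} [TopologicalSpace X]
    [TopologicalSpace Y] {f : X → Y} {B : Set Y} (hf : IsFiniteRamifiedCover f B) (S : Set Y)
    (hS : IsNowhereDense (Subtype.val ⁻¹' B : Set S)) :
    IsFiniteRamifiedCover (S.restrictPreimage f) (Subtype.val ⁻¹' B) where
  continuous := hf.continuous.restrictPreimage
  isOpenMap := hf.isOpenMap.restrictPreimage S
  isClosedMap := hf.isClosedMap.restrictPreimage S
  surjective := Set.restrictPreimage_surjective S hf.surjective
  finite_fiber y := by
    refine Set.Finite.of_finite_image ?_ Subtype.val_injective.injOn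
    rw [Set.image_val_restrictPreimage_fiber]
    exact hf.finite_fiber y.1
  isClosed_branch := hf.isClosed_branch.preimage continuous_subtype_val
  nowhereDense_branch := hS
  nowhereDense_preimage := hS.preimage_of_isOpenMap hf.continuous.restrictPreimage
    (hf.isOpenMap.restrictPreimage S)
  isCoveringMapOn := hf.isCoveringMapOn.restrictPreimage S
  exists_degree := by
    obtain ⟨d, hd⟩ := hf.exists_degree
    refine ⟨d, fun y hy => ?_⟩
    rw [← hd y.1 hy, ← Set.image_val_restrictPreimage_fiber,
      Set.ncard_image_of_injective _ Subtype.val_injective]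

theorem mainTheorem7 (n : ℕ) (hn : 2 ≤ n) :
    IsStratification (stratum n) ∧
    IsFiniteRamifiedCover (criticalValues n) (repeatedLocus n) ∧
    ∀ a : SigmaIndex n,
      IsFiniteRamifiedCover ((stratum n a).restrictPreimage (criticalValues n))
        (Subtype.val ⁻¹' repeatedLocus n) := by
  have : Nonempty (Fin (n - 1)) := ⟨⟨0, by omega⟩⟩
  exact ⟨isStratification_stratum n, isFiniteRamifiedCover_criticalValues, fun a =>
    isFiniteRamifiedCover_criticalValues.restrictPreimage _
      (isNowhereDense_repeatedLocus_stratum a)⟩
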